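/- Let $d\ge 1$ and let $P$ be a probability measure on $\mathbb{R}^d$ with Lebesgue density $p\colon\mathbb{R}^d\to[0,\infty)$, where $p\in W^{2,1}(\mathbb{R}^d)\cap W^{2,2}(\mathbb{R}^d)$, i.e. $p$ and its weak derivatives up to order $2$ are integrable and square-integrable. Let $K\colon\mathbb{R}^d\to[0,\infty)$ belong to $L^1(\mathbb{R}^d)\cap L^2(\mathbb{R}^d)$ with \[ \int K(u)\,du=1,\qquad \int u\,K(u)\,du=0,\qquad \int\|u\|^2K(u)\,du<\infty , \] and let $h=h_N>0$ be bandwidths with $h_N\to0$ and $Nh_N^d\to\infty$ as $N\to\infty$. Let $(Z_k)_{k\ge1}$ be random variables in $\mathbb{R}^d$ that are either i.i.d. with law $P$, or form a stationary Markov chain with invariant distribution $P$ and transition kernel $\kappa$ whose spectral gap $\gamma$ or pseudo spectral gap $\gamma_{\mathrm{ps}}$ is positive. Here $Tf(x)=\int f(y)\,\kappa(x,dy)$ is the Markov operator on the complex space $L^2_0(P)=\{f\in L^2(P):\int f\,dP=0\}$, $\gamma=\gamma(T)$ and \[ \gamma(A)=1-\sup\{\operatorname{Re}\lambda:\lambda\in\operatorname{spec}(A\text{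 on }L^2_0(P))\}, \qquad \gamma_{\mathrm{ps}}=\sup_{k\ge1}\frac{\gamma\big((T^*)^kT^k\big)}{k}. \] Let $\hat q_N(x)=\frac1N\sum_{k=1}^N h_N^{-d}K\big((Z_k-x)/h_N\big)$ and \[ \mathrm{MIAE}(\hat q_N)=\mathbb{E}\int_{\mathbb{R}^d}|\hat q_N(x)-p(x)|\,dx,\qquad \mathrm{MISE}(\hat q_N)=\mathbb{E}\int_{\mathbb{R}^d}(\hat q_N(x)-p(x))^2\,dx . \] For the $\mathrm{MIAE}$ bounds (and only for these) assume in addition the tail condition that, for some constants $C_p>0$ and $m>2d$, \[ \int_{\mathbb{R}^d}(1+\|u\|)^mK(u)^2\,du<\infty \quad\text{and}\quad p(x)\le C_p(1+\|x\|)^{-m}\ \text{ for all }x\in\mathbb{R}^d . \] Then, as $N\to\infty$, \[ \mathrm{MIAE}(\hat q_N)=\mathcal O\Big(\frac1{\sqrt{Nh_N^d}}+h_N^2\Big),\qquad \mathrm{MISE}(\hat q_N)=\mathcal O\Big(\frac1{Nh_N^d}+h_N^4\Big). \] If $h_N\asymp N^{-1/(d+4)}$, then \[ \mathrm{MIAE}(\hat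 q_N)=\mathcal O\big(N^{-2/(d+4)}\big),\qquad \mathrm{MISE}(\hat q_N)=\mathcal O\big(N^{-4/(d+4)}\big). \] This choice of bandwidth is asymptotically optimal for the two bounds: for every positive sequence $(b_N)$, the quantities $(Nb_N^d)^{-1/2}+b_N^2$ and $(Nb_N^d)^{-1}+b_N^4$ are bounded below by positive constant multiples of $N^{-2/(d+4)}$ and $N^{-4/(d+4)}$, respectively, for all large $N$, and each of them attains the corresponding order if and only if $b_N\asymp N^{-1/(d+4)}$. -/

import Mathlib

open MeasureTheory ProbabilityTheory Filter Topology
open scoped ENNReal NNReal InnerProductSpace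

noncomputable section

namespace KDE

/-! ### The Markov operator of a transition kernel on `L²(P)` and its spectral gaps -/

section MarkovOperator

variable {α : Type*} [MeasurableSpace α]

theorem ae_ae_of_invariant {κ : Kernel α α} {P : Measure α} (hκ : κ.Invariant P)
    {q : α → Prop} (hq : ∀ᵐ y ∂P, q y) : ∀ᵐ x ∂P, ∀ᵐ y ∂(κ x), q y := by
  refine Measure.ae_ae_of_ae_bind κ.measurable.aemeasurable ?_
  rwa [hκ.def]

theorem integrable_ae_of_invariant {κ : Kernel α α} [IsMarkovKernel κ] {P : Measure α}
    [IsProbabilityMeasure P] (hκ : κ.Invariant P) (f : Lp ℂ 2 P) :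
    ∀ᵐ x ∂P, Integrable f (κ x) := by
  have h1 : Integrable f (P.bind κ) := by
    rw [hκ.def]
    exact (Lp.memLp f).integrable one_le_two
  exact ((Measure.integrable_comp_iff h1.aestronglyMeasurable).1 h1).1

theorem eLpNorm_kernel_integral_le {κ : Kernel α α} [IsMarkovKernel κ] {P : Measure α}
    (hκ : κ.Invariant P) (f : Lp ℂ 2 P) :
    eLpNorm (fun x => ∫ y, f y ∂(κ x)) 2 P ≤ eLpNorm f 2 P := by
  have hf := (Lp.stronglyMeasurable f)
  rw [eLpNorm_eq_lintegral_rpow_enorm_toReal (by simp) (by simp),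
    eLpNorm_eq_lintegral_rpow_enorm_toReal (by simp) (by simp)]
  refine ENNReal.rpow_le_rpow ?_ (by positivity)
  have e : ∫⁻ y, ‖f y‖ₑ ^ (2 : ℝ≥0∞).toReal ∂P
      = ∫⁻ x, ∫⁻ y, ‖f y‖ₑ ^ (2 : ℝ≥0∞).toReal ∂(κ x) ∂P := by
    have h0 := Measure.lintegral_bind (m := P) κ.measurable.aemeasurable
      (hf.measurable.enorm.pow_const (2 : ℝ≥0∞).toReal).aemeasurable
    rwa [hκ.def] at h0
  rw [e]
  refine lintegral_mono fun x => ?_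
  have h1 : ‖∫ y, f y ∂(κ x)‖ₑ ≤ eLpNorm f 2 (κ x) :=
    calc ‖∫ y, f y ∂(κ x)‖ₑ ≤ eLpNorm f 1 (κ x) := by
          rw [eLpNorm_one_eq_lintegral_enorm]; exact enorm_integral_le_lintegral_enorm _
      _ ≤ eLpNorm f 2 (κ x) :=
          eLpNorm_le_eLpNorm_of_exponent_le one_le_two hf.aestronglyMeasurable
  calc ‖∫ y, f y ∂(κ x)‖ₑ ^ (2 : ℝ≥0∞).toReal
      ≤ (eLpNorm f 2 (κ x)) ^ (2 : ℝ≥0∞).toReal := by gcongr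
    _ = _ := by
      rw [eLpNorm_eq_lintegral_rpow_enorm_toReal (by simp) (by simp), ← ENNReal.rpow_mul]
      simp

theorem memLp_kernel_integral {κ : Kernel α α} [IsMarkovKernel κ] {P : Measure α}
    (hκ : κ.Invariant P) (f : Lp ℂ 2 P) :
    MemLp (fun x => ∫ y, f y ∂(κ x)) 2 P :=
  ⟨((Lp.stronglyMeasurable f).integral_kernel (κ := κ)).aestronglyMeasurable,
    (eLpNorm_kernel_integral_le hκ f).trans_lt (Lp.memLp f).2⟩

/-- The Markov operator `(T f)(x) = ∫ f(y) κ(x, dy)` on the complex Hilbert space `L²(P)`, for a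
Markov kernel `κ` with invariant distribution `P`. -/
def markovOp (κ : Kernel α α) [IsMarkovKernel κ] (P : Measure α) [IsProbabilityMeasure P]
    (hκ : κ.Invariant P) : Lp ℂ 2 P →L[ℂ] Lp ℂ 2 P :=
  LinearMap.mkContinuous
    { toFun := fun f => (memLp_kernel_integral hκ f).toLp _
      map_add' := by
        intro f g
        rw [← MemLp.toLp_add]
        refine MemLp.toLp_congr _ _ ?_
        filter_upwards [ae_ae_of_invariant hκ (Lp.coeFn_add f g),
          integrable_ae_of_invariant hκ f, integrable_ae_of_invariant hκ g] with x h1 h2 h3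
        rw [integral_congr_ae h1]
        exact integral_add h2 h3
      map_smul' := by
        intro c f
        rw [RingHom.id_apply, ← MemLp.toLp_const_smul]
        refine MemLp.toLp_congr _ _ ?_
        filter_upwards [ae_ae_of_invariant hκ (Lp.coeFn_smul c f)] with x h1
        rw [integral_congr_ae h1]
        exact integral_smul c _ }
    1 (by
      intro f
      rw [one_mul]
      simp only [LinearMap.coe_mk, AddHom.coe_mk]
      rw [Lp.norm_toLp, Lp.norm_def]
      exact ENNReal.toReal_mono (Lp.eLpNorm_ne_top f) (eLpNorm_kernel_integral_le hκ f))

theorem markovOp_coeFn (κ : Kernel α α) [IsMarkovKernel κ] (P : Measure α)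
    [IsProbabilityMeasure P] (hκ : κ.Invariant P) (f : Lp ℂ 2 P) :
    markovOp κ P hκ f =ᵐ[P] fun x => ∫ y, f y ∂(κ x) :=
  MemLp.coeFn_toLp (memLp_kernel_integral hκ f)

/-- `L²₀(P)`: the orthogonal complement of the constants in `L²(P)`, i.e. the functions of mean
zero (see `mem_L20_iff`). -/
abbrev L20 (P : Measure α) [IsProbabilityMeasure P] : Submodule ℂ (Lp ℂ 2 P) :=
  (ℂ ∙ indicatorConstLp (p := 2) (μ := P) MeasurableSet.univ (measure_ne_top P _) (1 : ℂ))ᗮ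

theorem mem_L20_iff (P : Measure α) [IsProbabilityMeasure P] (f : Lp ℂ 2 P) :
    f ∈ L20 P ↔ ∫ x, f x ∂P = 0 := by
  rw [Submodule.mem_orthogonal_singleton_iff_inner_right, L2.inner_indicatorConstLp_one,
    setIntegral_univ]

theorem markovOp_mem_L20 (κ : Kernel α α) [IsMarkovKernel κ] (P : Measure α)
    [IsProbabilityMeasure P] (hκ : κ.Invariant P) (f : L20 P) :
    markovOp κ P hκ f ∈ L20 P := by
  have hf := (mem_L20_iff P f).1 f.2
  rw [mem_L20_iff, integral_congr_ae (markovOp_coeFn κ P hκ f)]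
  have h1 : Integrable (f : Lp ℂ 2 P) (P.bind κ) := by
    rw [hκ.def]
    exact (Lp.memLp (f : Lp ℂ 2 P)).integrable one_le_two
  have e : (κ ∘ₖ Kernel.const Unit P) () = P.bind κ := by
    rw [Kernel.comp_apply, Kernel.const_apply]
  have h2 := Kernel.integral_comp (κ := Kernel.const Unit P) (η := κ) (a := ()) (e ▸ h1)
  rw [e, hκ.def, hf, Kernel.const_apply] at h2
  exact h2.symm

/-- The Markov operator restricted to the mean-zero functions `L²₀(P)`. -/
def markovOp0 (κ : Kernel α α) [IsMarkovKernel κ] (P : Measure α) [IsProbabilityMeasure P]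
    (hκ : κ.Invariant P) : L20 P →L[ℂ] L20 P :=
  ((markovOp κ P hκ).comp (L20 P).subtypeL).codRestrict (L20 P) (markovOp_mem_L20 κ P hκ)

/-- For an operator `A` on the mean-zero functions, `1 - sup {Re λ : λ ∈ spectrum A}`. When `A` is
self-adjoint the spectrum is real. -/
def opGap {P : Measure α} [IsProbabilityMeasure P] (A : L20 P →L[ℂ] L20 P) : ℝ :=
  1 - sSup (Complex.re '' spectrum ℂ A)

/-- The spectral gap `γ` of the transition kernel `κ` with invariant distribution `P`. Restricting
to `L²₀(P)` takes out the trivial eigenvalue `1` once, so `γ = 0` if it is not simple. -/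
def spectralGap (κ : Kernel α α) [IsMarkovKernel κ] (P : Measure α) [IsProbabilityMeasure P]
    (hκ : κ.Invariant P) : ℝ :=
  opGap (markovOp0 κ P hκ)

/-- The pseudo spectral gap `γ_ps = sup_{k ≥ 1} γ((T*)ᵏ Tᵏ) / k`. -/
def pseudoSpectralGap (κ : Kernel α α) [IsMarkovKernel κ] (P : Measure α)
    [IsProbabilityMeasure P] (hκ : κ.Invariant P) : ℝ :=
  ⨆ k : ℕ, opGap ((ContinuousLinearMap.adjoint (markovOp0 κ P hκ)) ^ (k + 1) *
    (markovOp0 κ P hκ) ^ (k + 1)) / ((k : ℝ) + 1)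

end MarkovOperator

/-! ### The two sampling schemes -/

section Sampling

variable {Ω α : Type*} [MeasurableSpace Ω] [MeasurableSpace α]

/-- `Z 0, Z 1, …` are i.i.d. samples from `P`. -/
structure IsIIDSample (μ : Measure Ω) (P : Measure α) (Z : ℕ → Ω → α) : Prop where
  measurable : ∀ k, Measurable (Z k)
  indep : iIndepFun Z μ
  law : ∀ k, μ.map (Z k) = P

/-- `Z 0, Z 1, …` is a time-homogeneous Markov chain with transition kernel `κ` that is started
in `P`: the conditional distribution of `Z (n + 1)` given `Z 0, …, Z n` is `κ (Z n, ·)`. It is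
stationary when `P` is invariant for `κ`. -/
structure IsMarkovChainFrom (μ : Measure Ω) (P : Measure α) (κ : Kernel α α)
    (Z : ℕ → Ω → α) : Prop where
  measurable : ∀ k, Measurable (Z k)
  initial : μ.map (Z 0) = P
  markov : ∀ n : ℕ,
    μ.map (fun ω => ((fun i : Fin (n + 1) => Z i ω), Z (n + 1) ω)) =
      (μ.map (fun ω => (fun i : Fin (n + 1) => Z i ω))) ⊗ₘ
        (κ.comap (fun z : Fin (n + 1) → α => z (Fin.last n)) (measurable_pi_apply _))

/-- `Z` is either an i.i.d. sequence with law `P`, or a stationary Markov chain with invariant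
distribution `P` and positive spectral gap or positive pseudo spectral gap. -/
def IsIIDOrStationaryWithGap (μ : Measure Ω) (P : Measure α) [IsProbabilityMeasure P]
    (Z : ℕ → Ω → α) : Prop :=
  IsIIDSample μ P Z ∨
    ∃ (κ : Kernel α α) (_ : IsMarkovKernel κ) (hκ : κ.Invariant P),
      IsMarkovChainFrom μ P κ Z ∧
        (0 < spectralGap κ P hκ ∨ 0 < pseudoSpectralGap κ P hκ)

end Sampling

/-! ### Sobolev spaces, the kernel density estimator and its errors -/

/-- `f ∈ W^{k,q}(ℝᵈ)`: `f` and its weak partial derivatives up to order `k` lie in `L^q`. The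
`n`-th order partial derivative in the coordinate directions `a 0, …, a (n - 1)` is tested against
smooth compactly supported functions. -/
def MemSobolev {d : ℕ} (k : ℕ) (q : ℝ≥0∞) (f : EuclideanSpace ℝ (Fin d) → ℝ) : Prop :=
  MemLp f q volume ∧
    ∀ n ≤ k, ∀ a : Fin n → Fin d, ∃ g : EuclideanSpace ℝ (Fin d) → ℝ, MemLp g q volume ∧
      ∀ φ : EuclideanSpace ℝ (Fin d) → ℝ, ContDiff ℝ ((⊤ : ℕ∞) : WithTop ℕ∞) φ → HasCompactSupport φ →
        ∫ x, f x * iteratedFDeriv ℝ n φ x (fun j => EuclideanSpace.single (a j) (1 : ℝ)) =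
          (-1) ^ n * ∫ x, g x * φ x

/-- The assumptions on kernel, bandwidth and density. -/
structure Assumptions {d : ℕ} (K : EuclideanSpace ℝ (Fin d) → ℝ) (h : ℕ → ℝ)
    (p : EuclideanSpace ℝ (Fin d) → ℝ) : Prop where
  K_nonneg : ∀ u, 0 ≤ K u
  K_L1 : MemLp K 1 volume
  K_L2 : MemLp K 2 volume
  K_mass : ∫ u, K u = 1
  K_first_moment : ∫ u, K u • u = 0
  K_second_moment : Integrable (fun u => ‖u‖ ^ 2 * |K u|)
  h_pos : ∀ N, 0 < h N
  h_tendsto : Tendsto h atTop (𝓝 0)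
  Nh_tendsto : Tendsto (fun N : ℕ => (N : ℝ) * h N ^ d) atTop atTop
  p_sobolev_one : MemSobolev 2 1 p
  p_sobolev_two : MemSobolev 2 2 p

/-- The polynomial tail condition on `p` together with the weighted moment condition on `K`. -/
def TailCondition {d : ℕ} (K p : EuclideanSpace ℝ (Fin d) → ℝ) : Prop :=
  ∃ C m : ℝ, 0 < C ∧ 2 * (d : ℝ) < m ∧
    Integrable (fun u => (1 + ‖u‖) ^ m * K u ^ 2) ∧
    ∀ x, p x ≤ C * (1 + ‖x‖) ^ (-m)

/-- `K_h(x, y) = h⁻ᵈ K((x - y) / h)`. -/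
def scaledKernel {d : ℕ} (K : EuclideanSpace ℝ (Fin d) → ℝ) (h : ℝ)
    (x y : EuclideanSpace ℝ (Fin d)) : ℝ :=
  1 / h ^ d * K (h⁻¹ • (x - y))

/-- The kernel density estimator built from the `N` samples `Z 0, …, Z (N - 1)`. -/
def kde {Ω : Type*} {d : ℕ} (K : EuclideanSpace ℝ (Fin d) → ℝ) (h : ℝ)
    (Z : ℕ → Ω → EuclideanSpace ℝ (Fin d)) (N : ℕ) (ω : Ω) (x : EuclideanSpace ℝ (Fin d)) : ℝ :=
  1 / (N : ℝ) * ∑ k ∈ Finset.range N, scaledKernel K h (Z k ω) x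

/-- The mean integrated absolute error of a random density `q`, as an extended real. -/
def MIAE {Ω : Type*} [MeasurableSpace Ω] {d : ℕ} (μ : Measure Ω)
    (q : Ω → EuclideanSpace ℝ (Fin d) → ℝ) (p : EuclideanSpace ℝ (Fin d) → ℝ) : ℝ≥0∞ :=
  ∫⁻ ω, (∫⁻ x, ENNReal.ofReal |q ω x - p x| ∂volume) ∂μ

/-- The mean integrated squared error of a random density `q`, as an extended real. -/
def MISE {Ω : Type*} [MeasurableSpace Ω] {d : ℕ} (μ : Measure Ω)
    (q : Ω → EuclideanSpace ℝ (Fin d) → ℝ) (p : EuclideanSpace ℝ (Fin d) → ℝ) : ℝ≥0∞ :=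
  ∫⁻ ω, (∫⁻ x, ENNReal.ofReal ((q ω x - p x) ^ 2) ∂volume) ∂μ

/-- `a N = O(b N)` as `N → ∞` for a sequence of extended nonnegative numbers; in particular `a N`
is finite for large `N`. -/
def IsBigOSeq (a : ℕ → ℝ≥0∞) (b : ℕ → ℝ) : Prop :=
  ∃ C : ℝ, ∀ᶠ N in atTop, a N ≤ ENNReal.ofReal (C * b N)

/-- The bound `1 / √(N hᵈ) + h²` for the MIAE. -/
def absBound (d : ℕ) (h : ℕ → ℝ) (N : ℕ) : ℝ := 1 / √((N : ℝ) * h N ^ d) + h N ^ 2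

/-- The bound `1 / (N hᵈ) + h⁴` for the MISE. -/
def sqBound (d : ℕ) (h : ℕ → ℝ) (N : ℕ) : ℝ := 1 / ((N : ℝ) * h N ^ d) + h N ^ 4

end KDE

end

noncomputable section

namespace KDE

/-! ### Invertibility of `1 - T` on mean-zero functions -/

section Hilbert

variable {H H' : Type*} [NormedAddCommGroup H] [InnerProductSpace ℂ H]
  [NormedAddCommGroup H'] [InnerProductSpace ℂ H']

/-! The error is split at the mean of the estimator into a stochastic part and a bias, and the two
are bounded separately.

Stochastic part: everything rests on `Var (∑_{k<N} f(Z_k)) ≤ C N ∫ f² dP` with `C` independent of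
`f`. For i.i.d. samples this is additivity of the variance. For a chain, the covariance at lag `m`
of a centred `f` is `⟪f, T^m f⟫`, so it suffices that the sums `∑_{i<n} T^i = (1 - T)⁻¹ (1 - T^n)`
are bounded on `L²₀(P)`. As `T` is a contraction, this only needs `1 - T` to be invertible, that is,
`1 ∉ spec T`; no decay of `T^n` is required. A spectral gap gives this at once; a pseudo spectral
gap gives `‖T^k‖ < 1` for some `k ≥ 1`, and `1 - T` is a factor of `1 - T^k`. With `f = K_h(·, x)`,
integration over `x` and the substitution `z = x + h u` yield the order `1 / (N h^d)` in squared
`L²`. In `L¹`, Cauchy–Schwarz against an integrable power of `1 + ‖x‖` reduces to a weighted second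
moment, which the tail condition controls (`exists_lintegral_weight_mul_le`).

Bias: the mean is `∫ K(u) p(x + h u) du`. A Sobolev function satisfies Taylor's formula with
integral remainder almost everywhere, as testing against smooth functions shows
(`ae_taylor_of_weak_deriv`). The mass and first moment of `K` remove the terms of order zero and
one. What remains is `h²` times averages of translates of the second derivatives, whose `L¹` and
`L²` norms do not depend on the translations.

Bandwidth: for `b = s r` with `r = N^(-1/(d+4))`, the absolute bound is `(s^(-d/2) + s²) r²`. The
function of `s` is at least `1` and is bounded exactly where `s` stays away from `0` and `∞`. The
squared bound is comparable to the square of the absolute one. -/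

theorem re_lt_one_of_sSup_lt_one [CompleteSpace H] {A : H →L[ℂ] H}
    (hA : 0 < 1 - sSup (Complex.re '' spectrum ℂ A)) {z : ℂ} (hz : z ∈ spectrum ℂ A) :
    z.re < 1 := by
  have hb : BddAbove (Complex.re '' spectrum ℂ A) :=
    ((spectrum.isCompact A).image Complex.continuous_re).bddAbove
  have := le_csSup hb (Set.mem_image_of_mem _ hz)
  linarith

theorem isUnit_one_sub_of_sSup_lt_one [CompleteSpace H] {A : H →L[ℂ] H}
    (hA : 0 < 1 - sSup (Complex.re '' spectrum ℂ A)) : IsUnit (1 - A) := by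
  by_contra hn
  have h1 : (1 : ℂ) ∈ spectrum ℂ A := by
    rw [spectrum.mem_iff, map_one]
    exact hn
  simpa using re_lt_one_of_sSup_lt_one hA h1

/-- The norm of a positive operator belongs to its spectrum, and `‖S* S‖ = ‖S‖²`. -/
theorem norm_lt_one_of_sSup_star_mul_self_lt_one [CompleteSpace H] {S : H →L[ℂ] H}
    (hS : 0 < 1 - sSup (Complex.re '' spectrum ℂ (star S * S))) : ‖S‖ < 1 := by
  -- On the zero space the spectrum is empty and does not contain the norm.
  rcases subsingleton_or_nontrivial (H →L[ℂ] H) with hsub | hnt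
  · rw [Subsingleton.elim S 0, norm_zero]
    exact one_pos
  · have h1 : ‖star S * S‖ ∈ spectrum ℝ (star S * S) :=
      CStarAlgebra.norm_mem_spectrum_of_nonneg (ha := star_mul_self_nonneg S)
    have h2 : ((‖star S * S‖ : ℝ) : ℂ) ∈ spectrum ℂ (star S * S) :=
      spectrum.algebraMap_mem ℂ h1
    have h3 := re_lt_one_of_sSup_lt_one hS h2
    rw [Complex.ofReal_re, CStarRing.norm_star_mul_self] at h3
    nlinarith [norm_nonneg S]

/-- The factors in `1 - a^n = (1 - a) ∑ a^i` commute, so each is a unit when the product is. -/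
theorem isUnit_one_sub_of_isUnit_one_sub_pow {R : Type*} [Ring R] {a : R} {n : ℕ}
    (h : IsUnit (1 - a ^ n)) : IsUnit (1 - a) := by
  rw [← mul_neg_geom_sum] at h
  have hc : Commute (1 - a) (∑ i ∈ Finset.range n, a ^ i) := by
    refine Commute.sum_right _ _ _ fun i _ => ?_
    exact (Commute.one_left _).sub_left (Commute.self_pow a i)
  exact (hc.isUnit_mul_iff.1 h).1

theorem isUnit_one_sub_of_sSup_adjoint_pow_lt_one [CompleteSpace H] {T : H →L[ℂ] H} {k : ℕ}
    (hT : 0 < 1 - sSup (Complex.re ''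
      spectrum ℂ ((ContinuousLinearMap.adjoint T) ^ k * T ^ k))) : IsUnit (1 - T) := by
  rw [← ContinuousLinearMap.star_eq_adjoint, ← star_pow] at hT
  exact isUnit_one_sub_of_isUnit_one_sub_pow
    (isUnit_one_sub_of_norm_lt_one (norm_lt_one_of_sSup_star_mul_self_lt_one hT))

/-- The sum telescopes to `(1 - T)⁻¹ (1 - T^n)`, and the second factor has norm at most `2`. The
powers themselves need not tend to zero: `-1` may lie in the spectrum. -/
theorem exists_norm_geom_sum_le {T : H →L[ℂ] H} (hT : ‖T‖ ≤ 1) (hu : IsUnit (1 - T)) :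
    ∃ C : ℝ, 0 ≤ C ∧ ∀ n, ‖∑ i ∈ Finset.range n, T ^ i‖ ≤ C := by
  obtain ⟨u, hu⟩ := hu
  refine ⟨‖(↑u⁻¹ : H →L[ℂ] H)‖ * 2, by positivity, fun n => ?_⟩
  have h1 : ∑ i ∈ Finset.range n, T ^ i = ↑u⁻¹ * (1 - T ^ n) := by
    rw [← mul_neg_geom_sum, ← hu, Units.inv_mul_cancel_left]
  have h0 : ‖(1 : H →L[ℂ] H)‖ ≤ 1 := ContinuousLinearMap.norm_id_le
  have h2 : ‖T ^ n‖ ≤ 1 := by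
    induction n with
    | zero => rwa [pow_zero]
    | succ n ih =>
      rw [pow_succ]
      have ih := ih (by rw [← mul_neg_geom_sum, ← hu, Units.inv_mul_cancel_left])
      exact (norm_mul_le _ _).trans (mul_le_one₀ ih (norm_nonneg _) hT)
  rw [h1]
  refine (norm_mul_le _ _).trans (mul_le_mul_of_nonneg_left ?_ (norm_nonneg _))
  calc ‖1 - T ^ n‖ ≤ ‖(1 : H →L[ℂ] H)‖ + ‖T ^ n‖ := norm_sub_le _ _
    _ ≤ 2 := by linarith

/-- Here `V k f` plays the role of `f(Z_k)`. The `N`-th term adds its own square `‖f‖²` and twice a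
cross term, in which the lags `1, …, N` add up to `⟪f, T (∑_{i<N} T^i) f⟫`; this is at most `C
‖f‖²`. -/
theorem norm_sum_sq_le_of_geom_sum_le (T : H →L[ℂ] H) (hT : ‖T‖ ≤ 1) {C : ℝ}
    (hC : ∀ n, ‖∑ i ∈ Finset.range n, T ^ i‖ ≤ C) (V : ℕ → H → H')
    (hV : ∀ i m f, ⟪V i f, V (i + m) f⟫_ℂ = ⟪f, (T ^ m) f⟫_ℂ) (f : H) (N : ℕ) :
    ‖∑ k ∈ Finset.range N, V k f‖ ^ 2 ≤ (1 + 2 * C) * N * ‖f‖ ^ 2 := by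
  have hC0 : 0 ≤ C := (norm_nonneg _).trans (hC 0)
  induction N with
  | zero => simp
  | succ N ih =>
    rw [Finset.sum_range_succ, @norm_add_sq ℂ]
    have h1 : ‖V N f‖ ^ 2 = ‖f‖ ^ 2 := by
      have h := hV N 0 f
      rw [add_zero, pow_zero, one_apply_eq_self,
        inner_self_eq_norm_sq_to_K, inner_self_eq_norm_sq_to_K] at h
      exact_mod_cast h
    have h2 : ⟪∑ k ∈ Finset.range N, V k f, V N f⟫_ℂ
        = ⟪f, T ((∑ i ∈ Finset.range N, T ^ i) f)⟫_ℂ := by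
      -- After reflection the index `i` stands for the lag `i + 1`, which leaves one extra factor
      -- `T`.
      rw [sum_inner, ← Finset.sum_range_reflect, _root_.sum_apply, map_sum, inner_sum]
      refine Finset.sum_congr rfl fun i hi => ?_
      have hi' := Finset.mem_range.1 hi
      have h3 := hV (N - 1 - i) (i + 1) f
      rw [show N - 1 - i + (i + 1) = N by omega, pow_succ'] at h3
      exact h3
    have h3 : RCLike.re ⟪∑ k ∈ Finset.range N, V k f, V N f⟫_ℂ ≤ C * ‖f‖ ^ 2 := by
      rw [h2]
      refine (RCLike.re_le_norm _).trans ((norm_inner_le_norm _ _).trans ?_)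
      have h4 : ‖T ((∑ i ∈ Finset.range N, T ^ i) f)‖ ≤ C * ‖f‖ := by
        refine (T.le_of_opNorm_le hT _).trans ?_
        rw [one_mul]
        exact ContinuousLinearMap.le_of_opNorm_le _ (hC N) f
      nlinarith [norm_nonneg f]
    rw [h1]
    push_cast
    nlinarith [h3, ih]

end Hilbert

/-! ### Consequences of the gap for the Markov operator -/

section Gap

variable {α : Type*} [MeasurableSpace α] {κ : Kernel α α} [IsMarkovKernel κ] {P : Measure α}
  [IsProbabilityMeasure P]

theorem isUnit_one_sub_markovOp0 {hκ : κ.Invariant P}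
    (h : 0 < spectralGap κ P hκ ∨ 0 < pseudoSpectralGap κ P hκ) :
    IsUnit (1 - markovOp0 κ P hκ) := by
  rcases h with h | h
  · exact isUnit_one_sub_of_sSup_lt_one h
  · obtain ⟨k, hk⟩ : ∃ k : ℕ, 0 < opGap ((ContinuousLinearMap.adjoint (markovOp0 κ P hκ)) ^ (k + 1)
        * (markovOp0 κ P hκ) ^ (k + 1)) / ((k : ℝ) + 1) := by
      -- A real supremum of nonpositive numbers is nonpositive, so some term of the supremum is
      -- positive.
      by_contra! hn
      exact absurd h (not_lt.2 (Real.iSup_nonpos hn))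
    have hk' := (div_pos_iff_of_pos_right (by positivity)).1 hk
    exact isUnit_one_sub_of_sSup_adjoint_pow_lt_one hk'

theorem norm_markovOp0_le (hκ : κ.Invariant P) : ‖markovOp0 κ P hκ‖ ≤ 1 := by
  refine ContinuousLinearMap.opNorm_le_bound _ zero_le_one fun f => ?_
  have h := (markovOp κ P hκ).le_of_opNorm_le
    (LinearMap.mkContinuous_norm_le _ zero_le_one _) (f : Lp ℂ 2 P)
  exact h

end Gap

/-! ### Second moments along a stationary Markov chain -/

section Chain

variable {Ω α : Type*} [MeasurableSpace Ω] [MeasurableSpace α] {μ : Measure Ω}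
  [IsProbabilityMeasure μ] {P : Measure α} {κ : Kernel α α}
  [IsMarkovKernel κ] {Z : ℕ → Ω → α}

theorem IsMarkovChainFrom.map_eq (hZ : IsMarkovChainFrom μ P κ Z) (hκ : κ.Invariant P) (n : ℕ) :
    μ.map (Z n) = P := by
  induction n with
  | zero => exact hZ.initial
  | succ n ih =>
    have hm : Measurable (fun ω => (fun i : Fin (n + 1) => Z i ω)) :=
      measurable_pi_lambda _ fun i => hZ.measurable i
    have h1 : μ.map (Z (n + 1)) =
        (μ.map (fun ω => ((fun i : Fin (n + 1) => Z i ω), Z (n + 1) ω))).snd := by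
      rw [Measure.snd, Measure.map_map measurable_snd (hm.prodMk (hZ.measurable _))]
      rfl
    have := Measure.isProbabilityMeasure_map (μ := μ) hm.aemeasurable
    rw [h1, hZ.markov n, Measure.snd_compProd]
    ext s hs
    rw [Measure.bind_apply hs (Kernel.aemeasurable _)]
    simp only [Kernel.comap_apply]
    rw [lintegral_map (f := fun z : Fin (n + 1) → α => κ (z (Fin.last n)) s)
      ((κ.measurable_coe hs).comp (measurable_pi_apply _)) hm]
    have h2 : ∫⁻ ω, κ (Z n ω) s ∂μ = ∫⁻ x, κ x s ∂(μ.map (Z n)) :=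
      (lintegral_map (κ.measurable_coe hs) (hZ.measurable n)).symm
    simp only [Fin.val_last]
    rw [h2, ih, ← Measure.bind_apply hs κ.aemeasurable, hκ.def]

theorem IsMarkovChainFrom.measurePreserving (hZ : IsMarkovChainFrom μ P κ Z)
    (hκ : κ.Invariant P) (n : ℕ) : MeasurePreserving (Z n) μ P :=
  ⟨hZ.measurable n, hZ.map_eq hκ n⟩

theorem IsIIDSample.variance_sum_le (hZ : IsIIDSample μ P Z) {f : α → ℝ} (hf : Measurable f)
    (hf2 : MemLp f 2 P) (N : ℕ) :
    Var[fun ω => ∑ k ∈ Finset.range N, f (Z k ω); μ] ≤ N * ∫ x, f x ^ 2 ∂P := by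
  have hmp : ∀ k, MeasurePreserving (Z k) μ P := fun k => ⟨hZ.measurable k, hZ.law k⟩
  have hfZ : ∀ k, MemLp (fun ω => f (Z k ω)) 2 μ := fun k => hf2.comp_measurePreserving (hmp k)
  have h1 : Var[fun ω => ∑ k ∈ Finset.range N, f (Z k ω); μ]
      = ∑ k ∈ Finset.range N, Var[fun ω => f (Z k ω); μ] := by
    rw [← IndepFun.variance_sum (fun k _ => hfZ k)
      (fun i _ j _ hij => (hZ.indep.indepFun hij).comp hf hf)]
    congr 1
    ext ω
    simp
  have h2 : ∀ k, Var[fun ω => f (Z k ω); μ] ≤ ∫ x, f x ^ 2 ∂P := fun k => by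
    refine (variance_le_expectation_sq (hfZ k).1).trans_eq ?_
    rw [← (hmp k).map_eq, integral_map (hmp k).aemeasurable (hf.pow_const 2).aestronglyMeasurable]
    rfl
  rw [h1]
  refine (Finset.sum_le_sum fun k _ => h2 k).trans_eq ?_
  simp

variable [IsProbabilityMeasure P]

/-- The one-step Markov property, in terms of `L²` inner products. -/
theorem IsMarkovChainFrom.inner_succ (hZ : IsMarkovChainFrom μ P κ Z) (hκ : κ.Invariant P)
    {i n : ℕ} (hi : i ≤ n) (f g : Lp ℂ 2 P) :
    ⟪Lp.compMeasurePreserving (Z i) (hZ.measurePreserving hκ i) f,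
      Lp.compMeasurePreserving (Z (n + 1)) (hZ.measurePreserving hκ (n + 1)) g⟫_ℂ =
    ⟪Lp.compMeasurePreserving (Z i) (hZ.measurePreserving hκ i) f,
      Lp.compMeasurePreserving (Z n) (hZ.measurePreserving hκ n) (markovOp κ P hκ g)⟫_ℂ := by
  have hm : Measurable (fun ω => (fun i : Fin (n + 1) => Z i ω)) :=
    measurable_pi_lambda _ fun i => hZ.measurable i
  have hm' := hm.prodMk (hZ.measurable (n + 1))
  have := Measure.isProbabilityMeasure_map (μ := μ) hm.aemeasurable
  have hf := Lp.stronglyMeasurable f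
  have hg := Lp.stronglyMeasurable g
  -- The left inner product is the integral of `F` against the joint law of the past and the next
  -- state. By `hZ.markov n` the next state can be integrated out first, which replaces `g` by its
  -- image under the kernel.
  let F : (Fin (n + 1) → α) × α → ℂ := fun z => ⟪f (z.1 ⟨i, by omega⟩), g z.2⟫_ℂ
  have hF : StronglyMeasurable F :=
    (hf.comp_measurable ((measurable_pi_apply _).comp measurable_fst)).inner
      (hg.comp_measurable measurable_snd)
  have hint0 := L2.integrable_inner (𝕜 := ℂ)
    (Lp.compMeasurePreserving (Z i) (hZ.measurePreserving hκ i) f)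
    (Lp.compMeasurePreserving (Z (n + 1)) (hZ.measurePreserving hκ (n + 1)) g)
  have e0 : (fun ω => ⟪Lp.compMeasurePreserving (Z i) (hZ.measurePreserving hκ i) f ω,
      Lp.compMeasurePreserving (Z (n + 1)) (hZ.measurePreserving hκ (n + 1)) g ω⟫_ℂ) =ᵐ[μ]
      fun ω => F ((fun i : Fin (n + 1) => Z i ω), Z (n + 1) ω) := by
    filter_upwards [Lp.coeFn_compMeasurePreserving f (hZ.measurePreserving hκ i),
      Lp.coeFn_compMeasurePreserving g (hZ.measurePreserving hκ (n + 1))] with ω h1 h2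
    rw [h1, h2]
    rfl
  have hint : Integrable F (μ.map (fun ω => ((fun i : Fin (n + 1) => Z i ω), Z (n + 1) ω))) :=
    (integrable_map_measure hF.aestronglyMeasurable hm'.aemeasurable).2 (hint0.congr e0)
  rw [L2.inner_def, L2.inner_def, integral_congr_ae e0,
    ← integral_map hm'.aemeasurable (f := F) hF.aestronglyMeasurable]
  rw [hZ.markov n] at hint ⊢
  rw [Measure.integral_compProd hint]
  have hmeas : StronglyMeasurable (fun z : Fin (n + 1) → α =>
      ∫ y, F (z, y) ∂(κ.comap (fun z : Fin (n + 1) → α => z (Fin.last n))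
        (measurable_pi_apply _) z)) :=
    hF.integral_kernel_prod_right'
  rw [integral_map hm.aemeasurable hmeas.aestronglyMeasurable]
  refine integral_congr_ae ?_
  have hT := (hZ.measurePreserving hκ n).quasiMeasurePreserving.ae (markovOp_coeFn κ P hκ g)
  have hI := (hZ.measurePreserving hκ n).quasiMeasurePreserving.ae
    (integrable_ae_of_invariant hκ g)
  filter_upwards [Lp.coeFn_compMeasurePreserving f (hZ.measurePreserving hκ i),
    Lp.coeFn_compMeasurePreserving (markovOp κ P hκ g) (hZ.measurePreserving hκ n), hT, hI]
    with ω h1 h2 h3 h4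
  rw [h1, h2]
  simp only [Function.comp_apply, F, Kernel.comap_apply, Fin.val_last]
  rw [h3, integral_inner h4]

/-- Each Markov step moves the later time back by one and replaces `g` by `T g`; hence the induction
runs over all `g`. At lag zero, composition with `Z i` is an isometry. -/
theorem IsMarkovChainFrom.inner_add (hZ : IsMarkovChainFrom μ P κ Z) (hκ : κ.Invariant P)
    (i m : ℕ) (f g : Lp ℂ 2 P) :
    ⟪Lp.compMeasurePreserving (Z i) (hZ.measurePreserving hκ i) f,
      Lp.compMeasurePreserving (Z (i + m)) (hZ.measurePreserving hκ (i + m)) g⟫_ℂ =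
    ⟪f, ((markovOp κ P hκ) ^ m) g⟫_ℂ := by
  induction m generalizing g with
  | zero =>
    exact (Lp.compMeasurePreservingₗᵢ ℂ (Z i) (hZ.measurePreserving hκ i)).inner_map_map f g
  | succ m ih =>
    have h1 := hZ.inner_succ hκ (Nat.le_add_right i m) f g
    rw [ih] at h1
    rw [pow_succ]
    exact h1

theorem coe_markovOp0_pow (hκ : κ.Invariant P) (m : ℕ) (f : L20 P) :
    (((markovOp0 κ P hκ) ^ m) f : Lp ℂ 2 P) = ((markovOp κ P hκ) ^ m) (f : Lp ℂ 2 P) := by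
  induction m generalizing f with
  | zero => rfl
  | succ m ih =>
    rw [pow_succ, pow_succ]
    exact ih (markovOp0 κ P hκ f)

theorem norm_toLp_sq {f : α → ℂ} {ν : Measure α} (hf : MemLp f 2 ν) :
    ‖hf.toLp f‖ ^ 2 = ∫ x, ‖f x‖ ^ 2 ∂ν := by
  have h := L2.inner_def (𝕜 := ℂ) (hf.toLp f) (hf.toLp f)
  rw [inner_self_eq_norm_sq_to_K] at h
  have h2 : ∫ x, ⟪hf.toLp f x, hf.toLp f x⟫_ℂ ∂ν = ∫ x, ((‖f x‖ ^ 2 : ℝ) : ℂ) ∂ν := by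
    refine integral_congr_ae ?_
    filter_upwards [hf.coeFn_toLp] with x hx
    rw [hx, inner_self_eq_norm_sq_to_K]
    norm_cast
  rw [h2, integral_complex_ofReal] at h
  refine Complex.ofReal_injective ?_
  rw [← h]
  push_cast
  rfl

theorem IsMarkovChainFrom.exists_variance_sum_le (hZ : IsMarkovChainFrom μ P κ Z)
    (hκ : κ.Invariant P) (hgap : 0 < spectralGap κ P hκ ∨ 0 < pseudoSpectralGap κ P hκ) :
    ∃ C : ℝ, 0 ≤ C ∧ ∀ f : α → ℝ, Measurable f → MemLp f 2 P → ∀ N : ℕ,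
      Var[fun ω => ∑ k ∈ Finset.range N, f (Z k ω); μ] ≤ C * N * ∫ x, f x ^ 2 ∂P := by
  obtain ⟨C, hC0, hC⟩ := exists_norm_geom_sum_le (norm_markovOp0_le hκ)
    (isUnit_one_sub_markovOp0 hgap)
  refine ⟨1 + 2 * C, by positivity, fun f hf hf2 N => ?_⟩
  have hmp := hZ.measurePreserving hκ
  -- Centring places `f` in `L²₀(P)`, where `1 - T` is invertible, and turns the squared norm of the
  -- sum into its variance.
  have hf0 : MemLp (fun x => ((f x - ∫ y, f y ∂P : ℝ) : ℂ)) 2 P :=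
    (hf2.sub (memLp_const _)).ofReal
  have hmem : hf0.toLp _ ∈ L20 P := by
    rw [mem_L20_iff, integral_congr_ae hf0.coeFn_toLp, integral_complex_ofReal,
      integral_sub (hf2.integrable one_le_two) (integrable_const _)]
    simp
  have key := norm_sum_sq_le_of_geom_sum_le (markovOp0 κ P hκ) (norm_markovOp0_le hκ) hC
    (fun k (g : L20 P) => Lp.compMeasurePreserving (Z k) (hmp k) (g : Lp ℂ 2 P))
    (fun i m g => by
      rw [hZ.inner_add hκ i m, ← coe_markovOp0_pow]
      rfl) ⟨_, hmem⟩ N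
  have hsum : ∀ n : ℕ, ⇑(∑ k ∈ Finset.range n, Lp.compMeasurePreserving (Z k) (hmp k)
      (hf0.toLp _)) =ᵐ[μ] fun ω => ∑ k ∈ Finset.range n, ((f (Z k ω) - ∫ y, f y ∂P : ℝ) : ℂ) := by
    intro n
    induction n with
    | zero =>
      simp only [Finset.range_zero, Finset.sum_empty]
      exact Lp.coeFn_zero ℂ 2 μ
    | succ n ih =>
      rw [Finset.sum_range_succ]
      filter_upwards [Lp.coeFn_add (∑ k ∈ Finset.range n, Lp.compMeasurePreserving (Z k) (hmp k)
        (hf0.toLp _)) (Lp.compMeasurePreserving (Z n) (hmp n) (hf0.toLp _)), ih,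
        Lp.coeFn_compMeasurePreserving (hf0.toLp _) (hmp n),
        (hmp n).quasiMeasurePreserving.ae hf0.coeFn_toLp] with ω h1 h2 h3 h4
      rw [h1, Pi.add_apply, h2, h3, Function.comp_apply, h4, Finset.sum_range_succ]
  have hfZ : ∀ k, MemLp (fun ω => f (Z k ω)) 2 μ := fun k => hf2.comp_measurePreserving (hmp k)
  have hmean : ∫ ω, ∑ k ∈ Finset.range N, f (Z k ω) ∂μ = N * ∫ y, f y ∂P := by
    rw [integral_finsetSum _ fun k _ => (hfZ k).integrable one_le_two]
    have : ∀ k, ∫ ω, f (Z k ω) ∂μ = ∫ y, f y ∂P := fun k => by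
      rw [← (hmp k).map_eq, integral_map (hmp k).aemeasurable hf.aestronglyMeasurable]
    simp [this]
  have hL : ‖∑ k ∈ Finset.range N, Lp.compMeasurePreserving (Z k) (hmp k) (hf0.toLp _)‖ ^ 2
      = Var[fun ω => ∑ k ∈ Finset.range N, f (Z k ω); μ] := by
    have hS := Lp.memLp (∑ k ∈ Finset.range N,
      Lp.compMeasurePreserving (Z k) (hmp k) (hf0.toLp _))
    have h1 := norm_toLp_sq hS
    rw [Lp.toLp_coeFn] at h1
    have hm : Measurable fun ω => ∑ k ∈ Finset.range N, f (Z k ω) :=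
      Finset.measurable_fun_sum _ fun k _ => hf.comp (hZ.measurable k)
    rw [h1, variance_eq_integral hm.aemeasurable]
    refine integral_congr_ae ?_
    filter_upwards [hsum N] with ω hω
    rw [hω, hmean, ← Complex.ofReal_sum, Complex.norm_real, Real.norm_eq_abs, sq_abs,
      Finset.sum_sub_distrib]
    simp
  -- Centring does not increase the second moment.
  have hR : ‖hf0.toLp _‖ ^ 2 ≤ ∫ x, f x ^ 2 ∂P := by
    rw [norm_toLp_sq]
    have h1 := variance_le_expectation_sq (μ := P) hf2.1
    rw [variance_eq_integral hf.aemeasurable] at h1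
    simpa only [Complex.norm_real, Real.norm_eq_abs, sq_abs, Pi.pow_apply] using h1
  rw [← hL]
  refine key.trans ?_
  exact mul_le_mul_of_nonneg_left hR (by positivity)

theorem IsIIDOrStationaryWithGap.measurePreserving (hZ : IsIIDOrStationaryWithGap μ P Z)
    (k : ℕ) : MeasurePreserving (Z k) μ P := by
  rcases hZ with hZ | ⟨κ, _, hκ, hZ, -⟩
  · exact ⟨hZ.measurable k, hZ.law k⟩
  · exact hZ.measurePreserving hκ k

/-- The variance of a sum along the sample grows at most linearly. -/
theorem IsIIDOrStationaryWithGap.exists_variance_sum_le (hZ : IsIIDOrStationaryWithGap μ P Z) :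
    ∃ C : ℝ, 0 ≤ C ∧ ∀ f : α → ℝ, Measurable f → MemLp f 2 P → ∀ N : ℕ,
      Var[fun ω => ∑ k ∈ Finset.range N, f (Z k ω); μ] ≤ C * N * ∫ x, f x ^ 2 ∂P := by
  rcases hZ with hZ | ⟨κ, _, hκ, hZ, hgap⟩
  · exact ⟨1, zero_le_one, fun f hf hf2 N => by simpa using hZ.variance_sum_le hf hf2 N⟩
  · exact hZ.exists_variance_sum_le hκ hgap

end Chain

/-! ### Balancing the bandwidth -/

section Rates

open Asymptotics

theorem rpow_neg_natCast_div (d N k : ℕ) :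
    (N : ℝ) ^ (-(k : ℝ) / (d + 4)) = ((N : ℝ) ^ (-(1 : ℝ) / (d + 4))) ^ k := by
  rw [← Real.rpow_natCast ((N : ℝ) ^ (-(1 : ℝ) / (d + 4))), ← Real.rpow_mul (Nat.cast_nonneg N)]
  congr 1
  ring

/-- With `r = N^(-1/(d+4))` one has `N r^d = r^(-4)`: variance and squared bias balance at this
bandwidth. -/
theorem natCast_mul_rpow_pow (d : ℕ) {N : ℕ} (hN : 0 < N) :
    (N : ℝ) * ((N : ℝ) ^ (-(1 : ℝ) / (d + 4))) ^ d = 1 / ((N : ℝ) ^ (-(1 : ℝ) / (d + 4))) ^ 4 := by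
  have hN' : (0 : ℝ) < N := by exact_mod_cast hN
  have hr : 0 < (N : ℝ) ^ (-(1 : ℝ) / (d + 4)) := Real.rpow_pos_of_pos hN' _
  rw [eq_div_iff (by positivity), mul_assoc, ← pow_add,
    ← Real.rpow_natCast _ (d + 4), ← Real.rpow_mul hN'.le]
  have : -(1 : ℝ) / (d + 4) * ((d + 4 : ℕ) : ℝ) = -1 := by
    push_cast
    field_simp
  rw [this, Real.rpow_neg_one, mul_inv_cancel₀ hN'.ne']

/-- Measuring the bandwidth in units of `r` separates the dependence on `N` from that on the ratio
`s`. -/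
theorem absBound_mul_rpow (d : ℕ) (b : ℕ → ℝ) {N : ℕ} (hN : 0 < N) {s : ℝ}
    (hb : b N = s * (N : ℝ) ^ (-(1 : ℝ) / (d + 4))) :
    absBound d b N = (1 / √(s ^ d) + s ^ 2) * (N : ℝ) ^ (-(2 : ℝ) / (d + 4)) := by
  have hN' : (0 : ℝ) < N := by exact_mod_cast hN
  have h2 := rpow_neg_natCast_div d N 2
  have h3 := natCast_mul_rpow_pow d hN
  push_cast at h2
  rw [absBound, hb, h2]
  set r : ℝ := (N : ℝ) ^ (-(1 : ℝ) / (d + 4)) with hr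
  have hr0 : 0 < r := Real.rpow_pos_of_pos hN' _
  have h4 : (N : ℝ) * (s * r) ^ d = s ^ d / (r ^ 2) ^ 2 := by
    rw [mul_pow, mul_left_comm, h3]
    field_simp
  rw [h4, Real.sqrt_div' _ (by positivity), Real.sqrt_sq (by positivity)]
  simp only [one_div, inv_div]
  ring

theorem one_le_one_div_sqrt_pow_add_sq (d : ℕ) {s : ℝ} (hs : 0 < s) :
    1 ≤ 1 / √(s ^ d) + s ^ 2 := by
  rcases le_total s 1 with h | h
  · have h1 : √(s ^ d) ≤ 1 := Real.sqrt_le_one.2 (pow_le_one₀ hs.le h)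
    have h2 : 1 ≤ 1 / √(s ^ d) := by
      rw [le_div_iff₀ (Real.sqrt_pos.2 (by positivity)), one_mul]
      exact h1
    nlinarith
  · have : 0 ≤ 1 / √(s ^ d) := by positivity
    nlinarith

theorem rpow_isBigO_absBound (d : ℕ) {b : ℕ → ℝ} (hb : ∀ N, 0 < b N) :
    (fun N : ℕ => (N : ℝ) ^ (-(2 : ℝ) / (d + 4))) =O[atTop] absBound d b := by
  refine IsBigO.of_bound 1 ?_
  filter_upwards [eventually_gt_atTop 0] with N hN
  have hN' : (0 : ℝ) < N := by exact_mod_cast hN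
  have hr : 0 < (N : ℝ) ^ (-(1 : ℝ) / (d + 4)) := Real.rpow_pos_of_pos hN' _
  have hr2 : 0 < (N : ℝ) ^ (-(2 : ℝ) / (d + 4)) := Real.rpow_pos_of_pos hN' _
  have hs : 0 < b N / (N : ℝ) ^ (-(1 : ℝ) / (d + 4)) := div_pos (hb N) hr
  rw [absBound_mul_rpow d b hN (div_mul_cancel₀ _ hr.ne').symm, norm_mul, one_mul]
  have h1 := one_le_one_div_sqrt_pow_add_sq d hs
  refine le_mul_of_one_le_left (norm_nonneg _) (h1.trans (le_abs_self _))

/-- A bound on `s^(-d/2) + s²` bounds `s` above through the second term and below through the first.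
The latter needs `d > 0`. -/
theorem absBound_isBigO_rpow_iff {d : ℕ} (hd : 0 < d) {b : ℕ → ℝ} (hb : ∀ N, 0 < b N) :
    ((absBound d b =O[atTop] fun N : ℕ => (N : ℝ) ^ (-(2 : ℝ) / (d + 4))) ↔
        b =Θ[atTop] fun N : ℕ => (N : ℝ) ^ (-(1 : ℝ) / (d + 4))) := by
  have hr : ∀ N : ℕ, 0 < N → ∀ k : ℝ, 0 < (N : ℝ) ^ k := fun N hN k =>
    Real.rpow_pos_of_pos (by exact_mod_cast hN) _
  have hmul : ∀ N : ℕ, 0 < N → b N = b N / (N : ℝ) ^ (-(1 : ℝ) / (d + 4)) *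
      (N : ℝ) ^ (-(1 : ℝ) / (d + 4)) := fun N hN => (div_mul_cancel₀ _ (hr N hN _).ne').symm
  constructor
  · intro h
    obtain ⟨C, hC, h⟩ := h.exists_pos
    rw [isBigOWith_iff] at h
    have key : ∀ᶠ N : ℕ in atTop, 0 < N ∧
        1 / √((b N / (N : ℝ) ^ (-(1 : ℝ) / (d + 4))) ^ d)
          + (b N / (N : ℝ) ^ (-(1 : ℝ) / (d + 4))) ^ 2 ≤ C := by
      filter_upwards [h, eventually_gt_atTop 0] with N h hN
      refine ⟨hN, ?_⟩
      rw [absBound_mul_rpow d b hN (hmul N hN), norm_mul] at h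
      exact (le_abs_self _).trans (le_of_mul_le_mul_right h (norm_pos_iff.2 (hr N hN _).ne'))
    constructor
    · refine IsBigO.of_bound (√C) ?_
      filter_upwards [key] with N ⟨hN, hk⟩
      have h1 := hr N hN (-(1 : ℝ) / (d + 4))
      rw [Real.norm_of_nonneg (hb N).le, Real.norm_of_nonneg h1.le, ← div_le_iff₀ h1]
      refine Real.le_sqrt_of_sq_le ?_
      have : 0 ≤ 1 / √((b N / (N : ℝ) ^ (-(1 : ℝ) / (d + 4))) ^ d) := by positivity
      linarith
    -- If `s ≤ 1`, then `1 ≤ C² s^d ≤ C² s`; if `s ≥ 1`, the constant `1` suffices.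
    · refine IsBigO.of_bound (max 1 (C ^ 2)) ?_
      filter_upwards [key] with N ⟨hN, hk⟩
      have h1 := hr N hN (-(1 : ℝ) / (d + 4))
      rw [Real.norm_of_nonneg (hb N).le, Real.norm_of_nonneg h1.le]
      set r := (N : ℝ) ^ (-(1 : ℝ) / (d + 4))
      set s := b N / r with hs
      have hs0 : 0 < s := div_pos (hb N) h1
      suffices h2 : 1 ≤ max 1 (C ^ 2) * s by
        rw [hmul N hN, ← mul_assoc]
        exact le_mul_of_one_le_left h1.le h2
      rcases le_total s 1 with h | h
      · have h3 : 1 / √(s ^ d) ≤ C := by nlinarith [sq_nonneg s]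
        have h4 : 0 < √(s ^ d) := Real.sqrt_pos.2 (by positivity)
        rw [div_le_iff₀ h4] at h3
        have h5 : 1 ≤ C ^ 2 * s ^ d := by
          have := Real.sq_sqrt (show 0 ≤ s ^ d by positivity)
          rw [← this, ← mul_pow]
          exact one_le_pow₀ h3
        have h6 : s ^ d ≤ s := pow_le_of_le_one hs0.le h hd.ne'
        calc 1 ≤ C ^ 2 * s ^ d := h5
          _ ≤ C ^ 2 * s := by gcongr
          _ ≤ _ := by gcongr; exact le_max_right _ _
      · exact one_le_mul_of_one_le_of_one_le (le_max_left _ _) h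
  · rintro ⟨hu, hl⟩
    obtain ⟨A, hA, hu⟩ := hu.exists_pos
    obtain ⟨B, hB, hl⟩ := hl.exists_pos
    rw [isBigOWith_iff] at hu hl
    -- The constant comes from `s⁻¹ ≤ B` in the first term and `s ≤ A` in the second.
    refine IsBigO.of_bound (√(B ^ d) + A ^ 2) ?_
    filter_upwards [hu, hl, eventually_gt_atTop 0] with N hu hl hN
    rw [absBound_mul_rpow d b hN (hmul N hN), norm_mul]
    refine mul_le_mul_of_nonneg_right ?_ (norm_nonneg _)
    have h1 := hr N hN (-(1 : ℝ) / (d + 4))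
    rw [Real.norm_of_nonneg (hb N).le, Real.norm_of_nonneg h1.le] at hu hl
    set r := (N : ℝ) ^ (-(1 : ℝ) / (d + 4))
    set s := b N / r with hs
    have hs0 : 0 < s := div_pos (hb N) h1
    rw [Real.norm_of_nonneg (by positivity)]
    have h2 : s ≤ A := by rwa [hs, div_le_iff₀ h1]
    have h3 : s⁻¹ ≤ B := by
      rw [hs, inv_div, div_le_iff₀ (hb N)]
      exact hl
    rw [one_div, ← Real.sqrt_inv, ← inv_pow]
    gcongr

/-- For `a, c ≥ 0`, `a² + c² ≤ (a + c)² ≤ 2 (a² + c²)`. All claims on the squared bound thus follow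
from those on the absolute one. -/
theorem sqBound_isTheta (d : ℕ) {b : ℕ → ℝ} (hb : ∀ N, 0 < b N) :
    sqBound d b =Θ[atTop] fun N => absBound d b N ^ 2 := by
  have hx : ∀ N : ℕ, 0 ≤ (N : ℝ) * b N ^ d := fun N =>
    mul_nonneg (Nat.cast_nonneg N) (pow_nonneg (hb N).le _)
  have hab : ∀ N, absBound d b N ^ 2 ≤ 2 * sqBound d b N ∧ sqBound d b N ≤ absBound d b N ^ 2 := by
    intro N
    have h1 : 1 / ((N : ℝ) * b N ^ d) = (1 / √((N : ℝ) * b N ^ d)) ^ 2 := by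
      rw [div_pow, one_pow, Real.sq_sqrt (hx N)]
    have h2 : 0 ≤ 1 / √((N : ℝ) * b N ^ d) := by positivity
    have h3 : 0 ≤ b N ^ 2 := by positivity
    rw [sqBound, absBound, h1]
    constructor
    · nlinarith [sq_nonneg (1 / √((N : ℝ) * b N ^ d) - b N ^ 2)]
    · nlinarith [mul_nonneg h2 h3]
  have h0 : ∀ N, 0 ≤ sqBound d b N := fun N => by linarith [(hab N).1, sq_nonneg (absBound d b N)]
  constructor
  · refine IsBigO.of_bound 1 (Eventually.of_forall fun N => ?_)
    rw [Real.norm_of_nonneg (h0 N), Real.norm_of_nonneg (sq_nonneg _), one_mul]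
    exact (hab N).2
  · refine IsBigO.of_bound 2 (Eventually.of_forall fun N => ?_)
    rw [Real.norm_of_nonneg (h0 N), Real.norm_of_nonneg (sq_nonneg _)]
    exact (hab N).1

theorem rpow_neg_four_eq_sq (d : ℕ) : (fun N : ℕ => (N : ℝ) ^ (-(4 : ℝ) / (d + 4))) =
    fun N : ℕ => ((N : ℝ) ^ (-(2 : ℝ) / (d + 4))) ^ 2 := by
  funext N
  have h2 := rpow_neg_natCast_div d N 2
  have h4 := rpow_neg_natCast_div d N 4
  push_cast at h2 h4
  rw [h2, h4, ← pow_mul]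

theorem rpow_isBigO_sqBound (d : ℕ) {b : ℕ → ℝ} (hb : ∀ N, 0 < b N) :
    (fun N : ℕ => (N : ℝ) ^ (-(4 : ℝ) / (d + 4))) =O[atTop] sqBound d b := by
  rw [rpow_neg_four_eq_sq]
  exact ((rpow_isBigO_absBound d hb).pow 2).trans (sqBound_isTheta d hb).2

theorem sqBound_isBigO_rpow_iff {d : ℕ} (hd : 0 < d) {b : ℕ → ℝ} (hb : ∀ N, 0 < b N) :
    ((sqBound d b =O[atTop] fun N : ℕ => (N : ℝ) ^ (-(4 : ℝ) / (d + 4))) ↔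
        b =Θ[atTop] fun N : ℕ => (N : ℝ) ^ (-(1 : ℝ) / (d + 4))) := by
  rw [rpow_neg_four_eq_sq, (sqBound_isTheta d hb).isBigO_congr_left, ← absBound_isBigO_rpow_iff hd hb]
  exact ⟨fun h => h.of_pow two_ne_zero, fun h => h.pow 2⟩

theorem IsBigOSeq.trans_isBigO {a : ℕ → ℝ≥0∞} {b c : ℕ → ℝ} (hab : IsBigOSeq a b)
    (hbc : b =O[atTop] c) (hc : ∀ N, 0 ≤ c N) : IsBigOSeq a c := by
  obtain ⟨C, hC⟩ := hab
  obtain ⟨D, hD⟩ := hbc.bound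
  refine ⟨|C| * D, ?_⟩
  filter_upwards [hC, hD] with N h1 h2
  refine h1.trans (ENNReal.ofReal_le_ofReal ?_)
  rw [Real.norm_of_nonneg (hc N)] at h2
  calc C * b N ≤ |C * b N| := le_abs_self _
    _ = |C| * ‖b N‖ := abs_mul _ _
    _ ≤ |C| * (D * c N) := by gcongr
    _ = _ := by ring

end Rates

/-! ### Second-order Taylor expansion of a Sobolev function -/

section Taylor

variable {E : Type*} [NormedAddCommGroup E] [NormedSpace ℝ E]

theorem taylor_two_sub {φ : E → ℝ} (hφ : ContDiff ℝ ((⊤ : ℕ∞) : WithTop ℕ∞) φ) (x v : E) :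
    φ (x - v) - φ x + fderiv ℝ φ x v =
      ∫ t in (0 : ℝ)..1, (1 - t) * fderiv ℝ (fderiv ℝ φ) (x - t • v) v v := by
  have hφ' : ContDiff ℝ ((⊤ : ℕ∞) : WithTop ℕ∞) (fderiv ℝ φ) := hφ.fderiv_right (by simp)
  have hφ'' : ContDiff ℝ ((⊤ : ℕ∞) : WithTop ℕ∞) (fderiv ℝ (fderiv ℝ φ)) :=
    hφ'.fderiv_right (by simp)
  have hl : ∀ t : ℝ, HasDerivAt (fun t : ℝ => x - t • v) (-v) t := fun t => by
    simpa using ((hasDerivAt_id t).smul_const v).const_sub x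
  have h1 : ∀ t : ℝ, HasDerivAt (fun t : ℝ => φ (x - t • v)) (fderiv ℝ φ (x - t • v) (-v)) t :=
    fun t => ((hφ.differentiable (by simp)) _).hasFDerivAt.comp_hasDerivAt t (hl t)
  have h2 : ∀ t : ℝ, HasDerivAt (fun t : ℝ => fderiv ℝ φ (x - t • v) v)
      (fderiv ℝ (fderiv ℝ φ) (x - t • v) (-v) v) t := fun t => by
    have h := ((hφ'.differentiable (by simp)) _).hasFDerivAt.comp_hasDerivAt t (hl t)
    exact (ContinuousLinearMap.apply ℝ ℝ v).hasFDerivAt.comp_hasDerivAt t h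
  -- This antiderivative replaces an integration by parts: the two first-derivative terms cancel.
  have h3 : ∀ t : ℝ, HasDerivAt (fun t : ℝ => φ (x - t • v) - (1 - t) * fderiv ℝ φ (x - t • v) v)
      ((1 - t) * fderiv ℝ (fderiv ℝ φ) (x - t • v) v v) t := fun t => by
    have h := (h1 t).sub (((hasDerivAt_id t).const_sub 1).mul (h2 t))
    refine h.congr_deriv ?_
    simp only [map_neg, _root_.neg_apply, id]
    ring
  have hc : Continuous fun t : ℝ => (1 - t) * fderiv ℝ (fderiv ℝ φ) (x - t • v) v v := by
    have : Continuous fun t : ℝ => fderiv ℝ (fderiv ℝ φ) (x - t • v) :=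
      hφ''.continuous.comp (by fun_prop)
    fun_prop
  rw [intervalIntegral.integral_eq_sub_of_hasDerivAt (fun t _ => h3 t)
    (hc.intervalIntegrable _ _)]
  simp only [one_smul, sub_self, zero_mul, sub_zero, zero_smul, one_mul]
  ring

theorem continuous_fderiv_fderiv_apply {φ : E → ℝ}
    (hφ : ContDiff ℝ ((⊤ : ℕ∞) : WithTop ℕ∞) φ) (v w : E) :
    Continuous fun x => fderiv ℝ (fderiv ℝ φ) x v w := by
  have hφ' : ContDiff ℝ ((⊤ : ℕ∞) : WithTop ℕ∞) (fderiv ℝ φ) := hφ.fderiv_right (by simp)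
  exact ((hφ'.continuous_fderiv (by simp)).clm_apply continuous_const).clm_apply continuous_const

theorem exists_bound_fderiv_fderiv_apply {φ : E → ℝ}
    (hφ : ContDiff ℝ ((⊤ : ℕ∞) : WithTop ℕ∞) φ) (hφc : HasCompactSupport φ) (v w : E) :
    ∃ C, ∀ x, ‖fderiv ℝ (fderiv ℝ φ) x v w‖ ≤ C := by
  refine HasCompactSupport.exists_bound_of_continuous (HasCompactSupport.intro hφc fun x hx => ?_)
    (continuous_fderiv_fderiv_apply hφ v w)
  rw [fderiv_of_notMem_tsupport (𝕜 := ℝ) fun h => hx (tsupport_fderiv_subset ℝ h)]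
  rfl

variable [FiniteDimensional ℝ E] [MeasurableSpace E] [BorelSpace E] {ν : Measure E}
  [ν.IsAddHaarMeasure]

theorem integrable_comp_add_smul {q : E → ℝ} (hq : Integrable q ν) (hqm : Measurable q) (v : E)
    (τ : Measure ℝ) [IsFiniteMeasure τ] :
    Integrable (fun z : E × ℝ => q (z.1 + z.2 • v)) (ν.prod τ) := by
  have hm : Measurable (fun z : E × ℝ => q (z.1 + z.2 • v)) := hqm.comp (by fun_prop)
  rw [integrable_prod_iff' hm.aestronglyMeasurable]
  refine ⟨Eventually.of_forall fun t => hq.comp_add_right (t • v), ?_⟩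
  have : (fun t : ℝ => ∫ x, ‖q (x + t • v)‖ ∂ν) = fun _ => ∫ x, ‖q x‖ ∂ν := by
    funext t
    exact integral_add_right_eq_self (fun x => ‖q x‖) (t • v)
  simp only [this]
  exact integrable_const _

/-- If `w` and `q` are the first and second weak derivatives of `p` in the direction `v`, then
`p` has the expected second-order expansion in this direction, almost everywhere. -/
theorem ae_taylor_of_weak_deriv {p w q : E → ℝ} {v : E} (hp : Integrable p ν)
    (hw : Integrable w ν) (hq : Integrable q ν) (hqm : Measurable q)
    (h1 : ∀ φ : E → ℝ, ContDiff ℝ ((⊤ : ℕ∞) : WithTop ℕ∞) φ → HasCompactSupport φ →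
      ∫ x, p x * fderiv ℝ φ x v ∂ν = -∫ x, w x * φ x ∂ν)
    (h2 : ∀ φ : E → ℝ, ContDiff ℝ ((⊤ : ℕ∞) : WithTop ℕ∞) φ → HasCompactSupport φ →
      ∫ x, p x * fderiv ℝ (fderiv ℝ φ) x v v ∂ν = ∫ x, q x * φ x ∂ν) :
    ∀ᵐ x ∂ν, p (x + v) - p x - w x = ∫ t in (0 : ℝ)..1, (1 - t) * q (x + t • v) := by
  set τ : Measure ℝ := volume.restrict (Set.Ioc 0 1) with hτ
  have hbt : ∀ᵐ t ∂τ, ‖1 - t‖ ≤ 1 := by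
    refine (ae_restrict_mem measurableSet_Ioc).mono fun t ht => ?_
    rw [Real.norm_eq_abs, abs_le]
    constructor <;> linarith [ht.1, ht.2]
  have hbt' : ∀ᵐ z ∂(ν.prod τ), ‖1 - z.2‖ ≤ 1 := Measure.quasiMeasurePreserving_snd.ae hbt
  have hQ : Integrable (fun z : E × ℝ => (1 - z.2) * q (z.1 + z.2 • v)) (ν.prod τ) :=
    (integrable_comp_add_smul hq hqm v τ).bdd_mul (c := 1)
      (by fun_prop) hbt'
  have hQ1 : Integrable (fun x => ∫ t, (1 - t) * q (x + t • v) ∂τ) ν := hQ.integral_prod_left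
  have hpv : Integrable (fun x => p (x + v)) ν := hp.comp_add_right v
  have hR : Integrable (fun x => p (x + v) - p x - w x - ∫ t, (1 - t) * q (x + t • v) ∂τ) ν :=
    ((hpv.sub hp).sub hw).sub hQ1
  suffices h : ∀ᵐ x ∂ν, p (x + v) - p x - w x - ∫ t, (1 - t) * q (x + t • v) ∂τ = 0 by
    filter_upwards [h] with x hx
    rw [intervalIntegral.integral_of_le zero_le_one]
    linarith
  -- It suffices to test against smooth `φ`. Translation by `v` passes from `p` to `φ`, the
  -- classical Taylor formula holds for `φ`, and the weak derivatives return the result to `w` and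
  -- `q`.
  refine ae_eq_zero_of_integral_contDiff_smul_eq_zero hR.locallyIntegrable fun φ hφ hφc => ?_
  have hφ' : ContDiff ℝ ((⊤ : ℕ∞) : WithTop ℕ∞) (fderiv ℝ φ) := hφ.fderiv_right (by simp)
  obtain ⟨C0, hC0⟩ := hφc.exists_bound_of_continuous hφ.continuous
  obtain ⟨C1, hC1⟩ := (hφc.fderiv ℝ).exists_bound_of_continuous hφ'.continuous
  obtain ⟨C2, hC2⟩ := exists_bound_fderiv_fderiv_apply hφ hφc v v
  have hφm : AEStronglyMeasurable φ ν := hφ.continuous.aestronglyMeasurable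
  have hI : ∀ {f : E → ℝ}, Integrable f ν → Integrable (fun x => f x * φ x) ν := fun hf =>
    hf.mul_bdd hφm (Eventually.of_forall hC0)
  have hIv : Integrable (fun x => p x * φ (x - v)) ν :=
    hp.mul_bdd (hφ.continuous.comp (by fun_prop : Continuous fun x : E => x - v)).aestronglyMeasurable
      (Eventually.of_forall fun x => hC0 _)
  have hI1 : Integrable (fun x => p x * fderiv ℝ φ x v) ν := by
    refine hp.mul_bdd (c := C1 * ‖v‖) ?_ (Eventually.of_forall fun x =>
      (fderiv ℝ φ x).le_of_opNorm_le (hC1 x) v)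
    have := hφ'.continuous
    exact (this.clm_apply continuous_const).aestronglyMeasurable
  have hD : Continuous fun z : E × ℝ => fderiv ℝ (fderiv ℝ φ) (z.1 - z.2 • v) v v :=
    (continuous_fderiv_fderiv_apply hφ v v).comp (by fun_prop)
  have hF1 : Integrable (fun z : E × ℝ => p z.1 *
      ((1 - z.2) * fderiv ℝ (fderiv ℝ φ) (z.1 - z.2 • v) v v)) (ν.prod τ) := by
    refine (hp.comp_fst τ).mul_bdd (c := C2) ?_ ?_
    · exact (Continuous.mul (by fun_prop) hD).aestronglyMeasurable
    · filter_upwards [hbt'] with z hz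
      rw [norm_mul]
      exact (mul_le_of_le_one_left (norm_nonneg _) hz).trans (hC2 _)
  have hF2 : Integrable (fun z : E × ℝ => (1 - z.2) * q (z.1 + z.2 • v) * φ z.1) (ν.prod τ) :=
    hQ.mul_bdd (hφ.continuous.comp continuous_fst).aestronglyMeasurable
      (Eventually.of_forall fun z => hC0 _)
  have e1 : ∫ x, p x * (φ (x - v) - φ x + fderiv ℝ φ x v) ∂ν =
      ∫ t, ∫ x, (1 - t) * q (x + t • v) * φ x ∂ν ∂τ := by
    calc ∫ x, p x * (φ (x - v) - φ x + fderiv ℝ φ x v) ∂ν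
        = ∫ x, ∫ t, p x * ((1 - t) * fderiv ℝ (fderiv ℝ φ) (x - t • v) v v) ∂τ ∂ν := by
          refine integral_congr_ae (Eventually.of_forall fun x => ?_)
          simp only
          rw [taylor_two_sub hφ, intervalIntegral.integral_of_le zero_le_one, integral_const_mul]
      _ = ∫ t, ∫ x, p x * ((1 - t) * fderiv ℝ (fderiv ℝ φ) (x - t • v) v v) ∂ν ∂τ :=
          integral_integral_swap hF1
      _ = _ := by
          refine integral_congr_ae (Eventually.of_forall fun t => ?_)
          -- The weak second derivative is tested against the translate `φ(· - t v)`; shifting back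
          -- moves the translation onto `q`.
          have h3 := h2 (fun x => φ (x - t • v)) (hφ.comp (by fun_prop))
            (hφc.comp_homeomorph (Homeomorph.subRight (t • v)))
          have h4 : fderiv ℝ (fun x => φ (x - t • v)) = fun x => fderiv ℝ φ (x - t • v) := by
            funext x
            exact fderiv_comp_sub _
          have h5 : ∀ x, fderiv ℝ (fun x => fderiv ℝ φ (x - t • v)) x =
            fderiv ℝ (fderiv ℝ φ) (x - t • v) := fun x => fderiv_comp_sub _
          simp only [h4, h5] at h3
          have h6 := integral_add_right_eq_self (μ := ν) (fun x => q x * φ (x - t • v)) (t • v)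
          simp only [add_sub_cancel_right] at h6
          simp only [mul_left_comm (p _), mul_assoc, integral_const_mul]
          rw [h3, h6]
  have e2 : ∫ t, ∫ x, (1 - t) * q (x + t • v) * φ x ∂ν ∂τ
      = ∫ x, (∫ t, (1 - t) * q (x + t • v) ∂τ) * φ x ∂ν := by
    rw [← integral_integral_swap hF2]
    simp only [integral_mul_const]
  have e3 : ∫ x, p x * (φ (x - v) - φ x + fderiv ℝ φ x v) ∂ν =
      ∫ x, p (x + v) * φ x ∂ν - ∫ x, p x * φ x ∂ν - ∫ x, w x * φ x ∂ν := by
    have h6 := integral_add_right_eq_self (μ := ν) (fun x => p x * φ (x - v)) v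
    simp only [add_sub_cancel_right] at h6
    have hs : Integrable (fun x => p x * φ (x - v) - p x * φ x) ν := hIv.sub (hI hp)
    rw [h6, sub_eq_add_neg _ (∫ x, w x * φ x ∂ν), ← h1 φ hφ hφc, ← integral_sub hIv (hI hp),
      ← integral_add hs hI1]
    refine integral_congr_ae (Eventually.of_forall fun x => ?_)
    ring
  have hs : Integrable (fun x => p (x + v) * φ x - p x * φ x) ν := (hI hpv).sub (hI hp)
  have hs' : Integrable (fun x => p (x + v) * φ x - p x * φ x - w x * φ x) ν := hs.sub (hI hw)
  have e4 : ∀ x, φ x • (p (x + v) - p x - w x - ∫ t, (1 - t) * q (x + t • v) ∂τ) =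
      p (x + v) * φ x - p x * φ x - w x * φ x - (∫ t, (1 - t) * q (x + t • v) ∂τ) * φ x :=
    fun x => by rw [smul_eq_mul]; ring
  simp only [e4]
  rw [integral_sub hs' (hI hQ1), integral_sub hs (hI hw), integral_sub (hI hpv) (hI hp),
    ← e2, ← e1, e3]
  ring

end Taylor

/-! ### Weak derivatives on Euclidean space -/

section Sobolev

variable {d : ℕ}

/-- The weak derivatives in `L¹` and in `L²` agree. -/
theorem exists_weak_deriv {p : EuclideanSpace ℝ (Fin d) → ℝ} (h1 : MemSobolev 2 1 p)
    (h2 : MemSobolev 2 2 p) {n : ℕ} (hn : n ≤ 2) (a : Fin n → Fin d) :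
    ∃ g : EuclideanSpace ℝ (Fin d) → ℝ, Measurable g ∧ MemLp g 1 volume ∧ MemLp g 2 volume ∧
      ∀ φ : EuclideanSpace ℝ (Fin d) → ℝ, ContDiff ℝ ((⊤ : ℕ∞) : WithTop ℕ∞) φ →
        HasCompactSupport φ →
        ∫ x, p x * iteratedFDeriv ℝ n φ x (fun j => EuclideanSpace.single (a j) (1 : ℝ)) =
          (-1) ^ n * ∫ x, g x * φ x := by
  obtain ⟨g, hg, hgφ⟩ := h1.2 n hn a
  obtain ⟨g', hg', hgφ'⟩ := h2.2 n hn a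
  have hgl : LocallyIntegrable g volume := (memLp_one_iff_integrable.1 hg).locallyIntegrable
  have hgl' : LocallyIntegrable g' volume := hg'.locallyIntegrable one_le_two
  have hI : ∀ {f φ : EuclideanSpace ℝ (Fin d) → ℝ}, LocallyIntegrable f volume →
      ContDiff ℝ ((⊤ : ℕ∞) : WithTop ℕ∞) φ → HasCompactSupport φ →
      Integrable (fun x => φ x * f x) := fun hf hφ hφc =>
    hf.integrable_smul_left_of_hasCompactSupport hφ.continuous hφc
  have hgg : g =ᵐ[volume] g' := by
    have h := ae_eq_zero_of_integral_contDiff_smul_eq_zero (hgl.sub hgl') fun φ hφ hφc => by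
      have e := (hgφ φ hφ hφc).symm.trans (hgφ' φ hφ hφc)
      have e := mul_left_cancel₀ (pow_ne_zero n (by norm_num)) e
      simp only [Pi.sub_apply, smul_eq_mul, mul_sub]
      rw [integral_sub (hI hgl hφ hφc) (hI hgl' hφ hφc)]
      simp only [mul_comm (φ _)]
      rw [e, sub_self]
    filter_upwards [h] with x hx
    exact sub_eq_zero.1 hx
  have hmk := hg.1.ae_eq_mk
  refine ⟨hg.1.mk g, hg.1.stronglyMeasurable_mk.measurable, hg.ae_eq hmk,
    (hg'.ae_eq hgg.symm).ae_eq hmk, fun φ hφ hφc => ?_⟩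
  rw [hgφ φ hφ hφc]
  congr 1
  refine integral_congr_ae ?_
  filter_upwards [hmk] with x hx
  rw [hx]

theorem sum_smul_single (v : EuclideanSpace ℝ (Fin d)) :
    ∑ i, v i • EuclideanSpace.single i (1 : ℝ) = v := by
  simpa using (EuclideanSpace.basisFun (Fin d) ℝ).sum_repr v

/-- A function in `W^{2,1} ∩ W^{2,2}` has a first-order expansion with a remainder that is
controlled by averages of a function in `L¹ ∩ L²`. -/
theorem MemSobolev.exists_taylor {p : EuclideanSpace ℝ (Fin d) → ℝ} (h1 : MemSobolev 2 1 p)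
    (h2 : MemSobolev 2 2 p) :
    ∃ (g : EuclideanSpace ℝ (Fin d) → EuclideanSpace ℝ (Fin d))
      (G : EuclideanSpace ℝ (Fin d) → ℝ), Measurable g ∧ Measurable G ∧
      MemLp G 1 volume ∧ MemLp G 2 volume ∧
      ∀ v, ∀ᵐ x, ‖p (x + v) - p x - ⟪g x, v⟫_ℝ‖ₑ ≤
        ‖v‖ₑ ^ 2 * ∫⁻ t in Set.Ioc (0 : ℝ) 1, ‖G (x + t • v)‖ₑ := by
  choose g1 hg1m hg11 hg12 hg1 using fun i : Fin d =>
    exists_weak_deriv h1 h2 one_le_two (fun _ => i)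
  choose g2 hg2m hg21 hg22 hg2 using fun i j : Fin d => exists_weak_deriv h1 h2 le_rfl ![i, j]
  have hp : Integrable p := memLp_one_iff_integrable.1 h1.1
  simp only [iteratedFDeriv_one_apply, iteratedFDeriv_two_apply, Matrix.cons_val_zero,
    Matrix.cons_val_one] at hg1 hg2
  -- `g` is the weak gradient. `G` sums the absolute values of all second derivatives, so `|∑ v_i
  -- v_j ∂_i ∂_j p| ≤ ‖v‖² G`.
  refine ⟨fun x => WithLp.toLp 2 fun i => g1 i x, fun x => ∑ i, ∑ j, ‖g2 i j x‖, ?_, ?_, ?_, ?_,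
    fun v => ?_⟩
  · exact (PiLp.continuous_toLp 2 _).measurable.comp (measurable_pi_lambda _ hg1m)
  · exact Finset.measurable_fun_sum _ fun i _ => Finset.measurable_fun_sum _ fun j _ =>
      (hg2m i j).norm
  · exact memLp_finsetSum _ fun i _ => memLp_finsetSum _ fun j _ => (hg21 i j).norm
  · exact memLp_finsetSum _ fun i _ => memLp_finsetSum _ fun j _ => (hg22 i j).norm
  · have hI1 : ∀ i, Integrable (fun x => v i * g1 i x) := fun i =>
      (memLp_one_iff_integrable.1 (hg11 i)).const_mul _
    have hI2 : ∀ i j, Integrable (fun x => v i * v j * g2 i j x) := fun i j =>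
      (memLp_one_iff_integrable.1 (hg21 i j)).const_mul _
    have hT := ae_taylor_of_weak_deriv (ν := volume) (p := p) (v := v)
      (w := fun x => ∑ i, v i * g1 i x) (q := fun x => ∑ i, ∑ j, v i * v j * g2 i j x) hp
      (integrable_finsetSum _ fun i _ => hI1 i)
      (integrable_finsetSum _ fun i _ => integrable_finsetSum _ fun j _ => hI2 i j)
      (Finset.measurable_fun_sum _ fun i _ => Finset.measurable_fun_sum _ fun j _ =>
        (hg2m i j).const_mul _) ?_ ?_
    · filter_upwards [hT] with x hx
      have e : ⟪WithLp.toLp 2 fun i => g1 i x, v⟫_ℝ = ∑ i, v i * g1 i x := by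
        simp [PiLp.inner_apply]
      rw [e, hx, intervalIntegral.integral_of_le zero_le_one]
      refine (enorm_integral_le_lintegral_enorm _).trans ?_
      rw [← lintegral_const_mul' _ _ (by simp)]
      refine lintegral_mono_ae ((ae_restrict_mem measurableSet_Ioc).mono fun t ht => ?_)
      rw [← enorm_norm v, ← enorm_pow, ← enorm_mul]
      refine enorm_le_iff_norm_le.2 ?_
      rw [norm_mul, norm_mul, norm_pow, norm_norm]
      have ht' : ‖1 - t‖ ≤ 1 := by
        rw [Real.norm_eq_abs, abs_le]
        constructor <;> linarith [ht.1, ht.2]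
      refine (mul_le_of_le_one_left (norm_nonneg _) ht').trans ?_
      rw [Real.norm_of_nonneg (Finset.sum_nonneg fun i _ => Finset.sum_nonneg fun j _ =>
        norm_nonneg _), Finset.mul_sum]
      refine (norm_sum_le _ _).trans (Finset.sum_le_sum fun i _ => ?_)
      rw [Finset.mul_sum]
      refine (norm_sum_le _ _).trans (Finset.sum_le_sum fun j _ => ?_)
      rw [norm_mul, norm_mul, sq]
      gcongr
      · exact PiLp.norm_apply_le v i
      · exact PiLp.norm_apply_le v j
    · intro φ hφ hφc
      have hφ' : ContDiff ℝ ((⊤ : ℕ∞) : WithTop ℕ∞) (fderiv ℝ φ) := hφ.fderiv_right (by simp)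
      obtain ⟨C0, hC0⟩ := hφc.exists_bound_of_continuous hφ.continuous
      obtain ⟨C1, hC1⟩ := (hφc.fderiv ℝ).exists_bound_of_continuous hφ'.continuous
      have hIφ : ∀ {f : EuclideanSpace ℝ (Fin d) → ℝ}, Integrable f →
          Integrable (fun x => f x * φ x) := fun hf =>
        hf.mul_bdd hφ.continuous.aestronglyMeasurable (Eventually.of_forall hC0)
      have hIp : ∀ e, Integrable (fun x => p x * fderiv ℝ φ x e) := fun e =>
        hp.mul_bdd (c := C1 * ‖e‖)
          (hφ'.continuous.clm_apply continuous_const).aestronglyMeasurable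
          (Eventually.of_forall fun x => (fderiv ℝ φ x).le_of_opNorm_le (hC1 x) e)
      have e1 : ∀ x, p x * fderiv ℝ φ x v
          = ∑ i, v i * (p x * fderiv ℝ φ x (EuclideanSpace.single i 1)) := fun x => by
        conv_lhs => rw [← sum_smul_single v]
        simp only [map_sum, map_smul, smul_eq_mul, Finset.mul_sum]
        exact Finset.sum_congr rfl fun i _ => by ring
      simp only [e1, Finset.sum_mul]
      rw [integral_finsetSum _ fun i _ => (hIp _).const_mul _,
        integral_finsetSum _ fun i _ => hIφ (hI1 i), ← Finset.sum_neg_distrib]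
      refine Finset.sum_congr rfl fun i _ => ?_
      simp only [mul_assoc, integral_const_mul]
      rw [hg1 i φ hφ hφc]
      ring
    · intro φ hφ hφc
      obtain ⟨C0, hC0⟩ := hφc.exists_bound_of_continuous hφ.continuous
      have hIφ : ∀ {f : EuclideanSpace ℝ (Fin d) → ℝ}, Integrable f →
          Integrable (fun x => f x * φ x) := fun hf =>
        hf.mul_bdd hφ.continuous.aestronglyMeasurable (Eventually.of_forall hC0)
      have hIp : ∀ e e', Integrable (fun x => p x * fderiv ℝ (fderiv ℝ φ) x e e') := fun e e' =>
        let ⟨_, hC⟩ := exists_bound_fderiv_fderiv_apply hφ hφc e e'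
        hp.mul_bdd (continuous_fderiv_fderiv_apply hφ e e').aestronglyMeasurable
          (Eventually.of_forall hC)
      have e1 : ∀ x, p x * fderiv ℝ (fderiv ℝ φ) x v v
          = ∑ i, ∑ j, v i * v j * (p x * fderiv ℝ (fderiv ℝ φ) x
            (EuclideanSpace.single i 1) (EuclideanSpace.single j 1)) := fun x => by
        conv_lhs => rw [← sum_smul_single v]
        simp only [map_sum, map_smul, smul_eq_mul, Finset.mul_sum, _root_.sum_apply,
          _root_.smul_apply]
        rw [Finset.sum_comm]
        exact Finset.sum_congr rfl fun i _ => Finset.sum_congr rfl fun j _ => by ring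
      simp only [e1, Finset.sum_mul]
      rw [integral_finsetSum _ fun i _ => integrable_finsetSum _ fun j _ => (hIp _ _).const_mul _,
        integral_finsetSum _ fun i _ => integrable_finsetSum _ fun j _ => hIφ (hI2 i j)]
      refine Finset.sum_congr rfl fun i _ => ?_
      rw [integral_finsetSum _ fun j _ => (hIp _ _).const_mul _,
        integral_finsetSum _ fun j _ => hIφ (hI2 i j)]
      refine Finset.sum_congr rfl fun j _ => ?_
      simp only [mul_assoc, integral_const_mul]
      rw [hg2 i j φ hφ hφc]
      ring

end Sobolev

/-! ### Integral inequalities -/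

section Lintegral

theorem sq_lintegral_mul_le {α : Type*} [MeasurableSpace α] {ν : Measure α} {f g : α → ℝ≥0∞}
    (hf : AEMeasurable f ν) (hg : AEMeasurable g ν) :
    (∫⁻ x, f x * g x ∂ν) ^ 2 ≤ (∫⁻ x, f x ^ 2 ∂ν) * ∫⁻ x, g x ^ 2 ∂ν := by
  have h := ENNReal.lintegral_mul_le_Lp_mul_Lq ν Real.HolderConjugate.two_two hf hg
  have hs : ∀ a : ℝ≥0∞, (a ^ (1 / (2 : ℝ))) ^ 2 = a := fun a => by
    rw [← ENNReal.rpow_natCast, ← ENNReal.rpow_mul]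
    simp
  calc (∫⁻ x, f x * g x ∂ν) ^ 2
      ≤ ((∫⁻ x, f x ^ (2 : ℝ) ∂ν) ^ (1 / (2 : ℝ)) * (∫⁻ x, g x ^ (2 : ℝ) ∂ν) ^ (1 / (2 : ℝ))) ^ 2 := by
        gcongr
        exact h
    _ = _ := by
        rw [mul_pow, hs, hs]
        simp only [ENNReal.rpow_two]

theorem sq_lintegral_le {α : Type*} [MeasurableSpace α] {ν : Measure α} {f : α → ℝ≥0∞}
    (hf : AEMeasurable f ν) : (∫⁻ x, f x ∂ν) ^ 2 ≤ ν Set.univ * ∫⁻ x, f x ^ 2 ∂ν := by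
  simpa using sq_lintegral_mul_le (aemeasurable_const (b := (1 : ℝ≥0∞))) hf

variable {E Y : Type*} [NormedAddCommGroup E] [NormedSpace ℝ E] [FiniteDimensional ℝ E]
  [MeasurableSpace E] [BorelSpace E] {ν : Measure E} [ν.IsAddHaarMeasure] [MeasurableSpace Y]

theorem lintegral_lintegral_comp_add {τ : Measure Y} [SFinite τ] {G : E → ℝ≥0∞} (hG : Measurable G)
    {a : Y → E} (ha : Measurable a) :
    ∫⁻ x, ∫⁻ y, G (x + a y) ∂τ ∂ν = τ Set.univ * ∫⁻ x, G x ∂ν := by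
  rw [lintegral_lintegral_swap (by fun_prop)]
  simp only [lintegral_add_right_eq_self G, lintegral_const, mul_comm]

/-- Cauchy–Schwarz in `y`, then Tonelli and translation invariance. The bound does not see the shift
`a`; for the bias this makes it uniform in `h`. -/
theorem lintegral_sq_lintegral_comp_add_le {τ : Measure Y} [SFinite τ] {G : E → ℝ≥0∞}
    (hG : Measurable G) {a : Y → E} (ha : Measurable a) :
    ∫⁻ x, (∫⁻ y, G (x + a y) ∂τ) ^ 2 ∂ν ≤ τ Set.univ ^ 2 * ∫⁻ x, G x ^ 2 ∂ν := by
  calc ∫⁻ x, (∫⁻ y, G (x + a y) ∂τ) ^ 2 ∂ν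
      ≤ ∫⁻ x, τ Set.univ * ∫⁻ y, G (x + a y) ^ 2 ∂τ ∂ν :=
        lintegral_mono fun x => sq_lintegral_le (by fun_prop)
    _ = τ Set.univ * (τ Set.univ * ∫⁻ x, G x ^ 2 ∂ν) := by
        rw [lintegral_const_mul _ (Measurable.lintegral_prod_right' (f := fun z : E × Y =>
          G (z.1 + a z.2) ^ 2) (by fun_prop)), lintegral_lintegral_comp_add (hG.pow_const 2) ha]
    _ = _ := by ring

theorem lintegral_comp_add_smul {F : E → ℝ≥0∞} (hF : Measurable F) {h : ℝ} (hh : 0 < h) (x : E) :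
    ∫⁻ z, F z ∂ν = ENNReal.ofReal (h ^ Module.finrank ℝ E) * ∫⁻ u, F (x + h • u) ∂ν := by
  have h1 : ∫⁻ u, F (x + h • u) ∂ν = ∫⁻ z, F (x + z) ∂(ν.map (h • ·)) :=
    (lintegral_map (hF.comp (measurable_const_add x)) (measurable_const_smul h)).symm
  rw [h1, Measure.map_addHaar_smul ν hh.ne', lintegral_smul_measure, lintegral_add_left_eq_self,
    smul_eq_mul, ← mul_assoc, ← ENNReal.ofReal_mul (by positivity), abs_of_pos (by positivity),
    mul_inv_cancel₀ (by positivity), ENNReal.ofReal_one, one_mul]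

theorem integral_comp_add_smul (F : E → ℝ) {h : ℝ} (hh : 0 < h) (x : E) :
    ∫ z, F z ∂ν = h ^ Module.finrank ℝ E * ∫ u, F (x + h • u) ∂ν := by
  rw [Measure.integral_comp_smul ν (fun z => F (x + z)) h, integral_add_left_eq_self,
    smul_eq_mul, ← mul_assoc, abs_of_pos (by positivity), mul_inv_cancel₀ (by positivity), one_mul]

end Lintegral

/-! ### The bias -/

section Bias

variable {d : ℕ} {K p : EuclideanSpace ℝ (Fin d) → ℝ} {P : Measure (EuclideanSpace ℝ (Fin d))}

theorem integral_scaledKernel (hp : ∀ x, 0 ≤ p x) (hpm : Measurable p)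
    (hP : P = volume.withDensity (fun x => ENNReal.ofReal (p x))) {h : ℝ} (hh : 0 < h)
    (x : EuclideanSpace ℝ (Fin d)) :
    ∫ z, scaledKernel K h z x ∂P = ∫ u, K u * p (x + h • u) := by
  rw [hP, integral_withDensity_eq_integral_toReal_smul (by fun_prop) (by simp),
    integral_comp_add_smul _ hh x, finrank_euclideanSpace_fin, ← integral_const_mul]
  refine integral_congr_ae (Eventually.of_forall fun u => ?_)
  simp only [scaledKernel, add_sub_cancel_left, smul_smul, inv_mul_cancel₀ hh.ne', one_smul,
    ENNReal.toReal_ofReal (hp _), smul_eq_mul]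
  field_simp

theorem ae_enorm_bias_le (hK : ∀ u, 0 ≤ K u) (hKm : Measurable K) (hK1 : Integrable K)
    (hKmass : ∫ u, K u = 1) (hKfirst : ∫ u, K u • u = 0)
    (hKsecond : Integrable fun u => ‖u‖ ^ 2 * K u)
    (hpm : Measurable p) (hpI : Integrable p)
    {g : EuclideanSpace ℝ (Fin d) → EuclideanSpace ℝ (Fin d)} {G : EuclideanSpace ℝ (Fin d) → ℝ}
    (hg : Measurable g) (hG : Measurable G)
    (hT : ∀ v, ∀ᵐ x, ‖p (x + v) - p x - ⟪g x, v⟫_ℝ‖ₑ ≤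
        ‖v‖ₑ ^ 2 * ∫⁻ t in Set.Ioc (0 : ℝ) 1, ‖G (x + t • v)‖ₑ) {h : ℝ} (hh : 0 < h) :
    ∀ᵐ x, ‖(∫ u, K u * p (x + h • u)) - p x‖ₑ ≤ ENNReal.ofReal (h ^ 2) *
      ∫⁻ y, ‖G (x + (y.2 * h) • y.1)‖ₑ
        ∂((volume.withDensity fun u => ENNReal.ofReal (‖u‖ ^ 2 * K u)).prod
          (volume.restrict (Set.Ioc (0 : ℝ) 1))) := by
  have hGm : Measurable fun z : EuclideanSpace ℝ (Fin d) × EuclideanSpace ℝ (Fin d) =>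
      ∫⁻ t in Set.Ioc (0 : ℝ) 1, ‖G (z.2 + t • (h • z.1))‖ₑ :=
    Measurable.lintegral_prod_right' (f := fun w : (EuclideanSpace ℝ (Fin d) ×
      EuclideanSpace ℝ (Fin d)) × ℝ => ‖G (w.1.2 + w.2 • (h • w.1.1))‖ₑ) (by fun_prop)
  -- The exceptional null set in the expansion depends on the increment; Fubini makes almost every
  -- `x` good for almost every `u`.
  have hswap : ∀ᵐ x, ∀ᵐ u, ‖p (x + h • u) - p x - ⟪g x, h • u⟫_ℝ‖ₑ ≤
        ‖h • u‖ₑ ^ 2 * ∫⁻ t in Set.Ioc (0 : ℝ) 1, ‖G (x + t • (h • u))‖ₑ := by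
    refine (Measure.ae_ae_comm (μ := volume) (ν := volume) (p := fun u x =>
      ‖p (x + h • u) - p x - ⟪g x, h • u⟫_ℝ‖ₑ ≤
        ‖h • u‖ₑ ^ 2 * ∫⁻ t in Set.Ioc (0 : ℝ) 1, ‖G (x + t • (h • u))‖ₑ) ?_).1
      (Eventually.of_forall fun u => hT (h • u))
    refine measurableSet_le ?_ ?_
    · fun_prop
    · exact Measurable.mul (by fun_prop) hGm
  have hint : ∀ᵐ x, Integrable fun u => K u * p (x + h • u) := by
    have hm : Measurable fun z : EuclideanSpace ℝ (Fin d) × EuclideanSpace ℝ (Fin d) =>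
      K z.2 * p (z.1 + h • z.2) := by fun_prop
    have hi : Integrable (fun z : EuclideanSpace ℝ (Fin d) × EuclideanSpace ℝ (Fin d) =>
        K z.2 * p (z.1 + h • z.2)) (volume.prod volume) := by
      rw [integrable_prod_iff' hm.aestronglyMeasurable]
      refine ⟨Eventually.of_forall fun u =>
        (hpI.comp_add_right (h • u)).const_mul (K u), ?_⟩
      have e : ∀ u, ∫ x, ‖K u * p (x + h • u)‖ = ‖K u‖ * ∫ x, ‖p x‖ := fun u => by
        simp only [norm_mul, integral_const_mul]
        rw [integral_add_right_eq_self (fun x => ‖p x‖)]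
      simp only [e]
      exact hK1.norm.mul_const _
    exact hi.prod_right_ae
  have hfirst : Integrable fun u => K u • u := by
    refine (hK1.add hKsecond).mono' (by fun_prop) (Eventually.of_forall fun u => ?_)
    rw [norm_smul, Real.norm_of_nonneg (hK u), Pi.add_apply]
    nlinarith [hK u, sq_nonneg (‖u‖ - 1), mul_nonneg (hK u) (sq_nonneg (‖u‖ - 1)),
      mul_nonneg (hK u) (sq_nonneg ‖u‖)]
  filter_upwards [hswap, hint] with x hx hxi
  -- Unit mass allows `p x` to be moved inside the integral, and the vanishing first moment allows
  -- the gradient term to be subtracted.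
  have e1 : (∫ u, K u * p (x + h • u)) - p x
      = ∫ u, K u * (p (x + h • u) - p x - ⟪g x, h • u⟫_ℝ) := by
    have hi2 : Integrable fun u => K u * p x := hK1.mul_const _
    have hi3 : Integrable fun u => ⟪g x, K u • u⟫_ℝ := hfirst.const_inner _
    have e2 : ∀ u, K u * (p (x + h • u) - p x - ⟪g x, h • u⟫_ℝ)
        = K u * p (x + h • u) - K u * p x - h * ⟪g x, K u • u⟫_ℝ := fun u => by
      rw [inner_smul_right, inner_smul_right]
      ring
    have hi4 : Integrable fun u => K u * p (x + h • u) - K u * p x := hxi.sub hi2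
    simp only [e2]
    rw [integral_sub hi4 (hi3.const_mul h), integral_sub hxi hi2, integral_mul_const, hKmass,
      integral_const_mul, integral_inner hfirst, hKfirst, inner_zero_right]
    ring
  rw [e1, lintegral_prod _ (by fun_prop), lintegral_withDensity_eq_lintegral_mul _ (by fun_prop)
    (Measurable.lintegral_prod_right' (f := fun w : EuclideanSpace ℝ (Fin d) × ℝ =>
      ‖G (x + (w.2 * h) • w.1)‖ₑ) (by fun_prop)), ← lintegral_const_mul' _ _ (by simp)]
  refine (enorm_integral_le_lintegral_enorm _).trans (lintegral_mono_ae ?_)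
  filter_upwards [hx] with u hu
  rw [enorm_mul, Real.enorm_of_nonneg (hK u), Pi.mul_apply]
  calc ENNReal.ofReal (K u) * ‖p (x + h • u) - p x - ⟪g x, h • u⟫_ℝ‖ₑ
      ≤ ENNReal.ofReal (K u) * (‖h • u‖ₑ ^ 2 *
        ∫⁻ t in Set.Ioc (0 : ℝ) 1, ‖G (x + t • (h • u))‖ₑ) := by gcongr
    _ = _ := by
      have e3 : ENNReal.ofReal (h ^ 2) * ENNReal.ofReal (‖u‖ ^ 2 * K u)
          = ENNReal.ofReal (K u) * ‖h • u‖ₑ ^ 2 := by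
        rw [← ofReal_norm, norm_smul, Real.norm_of_nonneg hh.le,
          ← ENNReal.ofReal_pow (by positivity), ← ENNReal.ofReal_mul (by positivity),
          ← ENNReal.ofReal_mul (hK u)]
        congr 1
        ring
      rw [← mul_assoc, ← mul_assoc, e3]
      simp only [smul_smul]

/-- The bias of the estimator is of order `h²`, in `L¹` and in `L²`. -/
theorem exists_bias_le (hK : ∀ u, 0 ≤ K u) (hKm : Measurable K) (hK1 : Integrable K)
    (hKmass : ∫ u, K u = 1) (hKfirst : ∫ u, K u • u = 0)
    (hKsecond : Integrable fun u => ‖u‖ ^ 2 * K u)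
    (hp : ∀ x, 0 ≤ p x) (hpm : Measurable p) (hp1 : MemSobolev 2 1 p) (hp2 : MemSobolev 2 2 p)
    (hP : P = volume.withDensity (fun x => ENNReal.ofReal (p x))) :
    ∃ A B : ℝ≥0∞, A ≠ ∞ ∧ B ≠ ∞ ∧ ∀ h : ℝ, 0 < h →
      ∫⁻ x, ‖∫ z, scaledKernel K h z x ∂P - p x‖ₑ ≤ A * ENNReal.ofReal (h ^ 2) ∧
      ∫⁻ x, ‖∫ z, scaledKernel K h z x ∂P - p x‖ₑ ^ 2 ≤ B * ENNReal.ofReal (h ^ 4) := by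
  obtain ⟨g, G, hg, hG, hG1, hG2, hT⟩ := hp1.exists_taylor hp2
  have hpI : Integrable p := memLp_one_iff_integrable.1 hp1.1
  set τ := (volume.withDensity fun u : EuclideanSpace ℝ (Fin d) =>
    ENNReal.ofReal (‖u‖ ^ 2 * K u)).prod (volume.restrict (Set.Ioc (0 : ℝ) 1)) with hτ
  have : IsFiniteMeasure (volume.withDensity fun u : EuclideanSpace ℝ (Fin d) =>
      ENNReal.ofReal (‖u‖ ^ 2 * K u)) := by
    refine isFiniteMeasure_withDensity ?_
    rw [← ofReal_integral_eq_lintegral_ofReal hKsecond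
      (Eventually.of_forall fun u => mul_nonneg (sq_nonneg _) (hK u))]
    exact ENNReal.ofReal_ne_top
  have hτf : IsFiniteMeasure τ := by rw [hτ]; infer_instance
  have hGf1 : ∫⁻ x, ‖G x‖ₑ ≠ ∞ := (memLp_one_iff_integrable.1 hG1).2.ne
  have hGf2 : ∫⁻ x, ‖G x‖ₑ ^ 2 ≠ ∞ := by
    have h := lintegral_rpow_enorm_lt_top_of_eLpNorm_lt_top (by simp) (by simp) hG2.2
    simpa using h.ne
  refine ⟨τ Set.univ * ∫⁻ x, ‖G x‖ₑ, τ Set.univ ^ 2 * ∫⁻ x, ‖G x‖ₑ ^ 2,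
    ENNReal.mul_ne_top (measure_ne_top _ _) hGf1,
    ENNReal.mul_ne_top (ENNReal.pow_ne_top (measure_ne_top _ _)) hGf2, fun h hh => ?_⟩
  have hb := ae_enorm_bias_le hK hKm hK1 hKmass hKfirst hKsecond hpm hpI hg hG hT hh
  rw [← hτ] at hb
  simp only [integral_scaledKernel hp hpm hP hh]
  have ha : Measurable fun y : EuclideanSpace ℝ (Fin d) × ℝ => (y.2 * h) • y.1 := by fun_prop
  constructor
  · refine (lintegral_mono_ae hb).trans_eq ?_
    rw [lintegral_const_mul' _ _ (by simp), lintegral_lintegral_comp_add hG.enorm ha, mul_comm]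
  · calc ∫⁻ x, ‖(∫ u, K u * p (x + h • u)) - p x‖ₑ ^ 2
        ≤ ∫⁻ x, ENNReal.ofReal (h ^ 4) * (∫⁻ y, ‖G (x + (y.2 * h) • y.1)‖ₑ ∂τ) ^ 2 := by
          refine lintegral_mono_ae (hb.mono fun x hx => ?_)
          refine (pow_le_pow_left' hx 2).trans_eq ?_
          rw [mul_pow, ← ENNReal.ofReal_pow (by positivity), ← pow_mul]
      _ ≤ _ := by
          rw [lintegral_const_mul' _ _ (by simp), mul_comm]
          gcongr
          exact lintegral_sq_lintegral_comp_add_le hG.enorm ha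

end Bias

/-! ### The stochastic error -/

section Variance

theorem IsIIDOrStationaryWithGap.exists_lintegral_average_le {Ω α : Type*} [MeasurableSpace Ω]
    [MeasurableSpace α] {μ : Measure Ω} [IsProbabilityMeasure μ] {P : Measure α}
    [IsProbabilityMeasure P] {Z : ℕ → Ω → α} (hZ : IsIIDOrStationaryWithGap μ P Z) :
    ∃ C : ℝ, 0 < C ∧ ∀ f : α → ℝ, Measurable f → ∀ N : ℕ, 0 < N →
      ∫⁻ ω, ‖1 / (N : ℝ) * ∑ k ∈ Finset.range N, f (Z k ω) - ∫ x, f x ∂P‖ₑ ^ 2 ∂μ ≤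
        ENNReal.ofReal (C / N) * ∫⁻ x, ENNReal.ofReal (f x ^ 2) ∂P := by
  obtain ⟨C, hC0, hC⟩ := hZ.exists_variance_sum_le
  -- The constant must be strictly positive so that the right-hand side is `∞` when `f` is not in
  -- `L²(P)`.
  refine ⟨C + 1, by positivity, fun f hf N hN => ?_⟩
  have hN' : (0 : ℝ) < N := by exact_mod_cast hN
  by_cases hf2 : MemLp f 2 P
  · have hfZ : ∀ k, MemLp (fun ω => f (Z k ω)) 2 μ := fun k =>
      hf2.comp_measurePreserving (hZ.measurePreserving k)
    have hX : MemLp (fun ω => 1 / (N : ℝ) * ∑ k ∈ Finset.range N, f (Z k ω)) 2 μ :=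
      (memLp_finsetSum _ fun k _ => hfZ k).const_mul _
    have hmean : ∫ ω, 1 / (N : ℝ) * ∑ k ∈ Finset.range N, f (Z k ω) ∂μ = ∫ x, f x ∂P := by
      rw [integral_const_mul, integral_finsetSum _ fun k _ => (hfZ k).integrable one_le_two]
      have h : ∀ k, ∫ ω, f (Z k ω) ∂μ = ∫ y, f y ∂P := fun k => by
        rw [← (hZ.measurePreserving k).map_eq,
          integral_map (hZ.measurePreserving k).aemeasurable hf.aestronglyMeasurable]
      simp only [h, Finset.sum_const, Finset.card_range, nsmul_eq_mul]
      field_simp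
    have hvar := ofReal_variance hX
    rw [evariance, hmean] at hvar
    rw [← hvar, variance_const_mul, ← ofReal_integral_eq_lintegral_ofReal hf2.integrable_sq
      (Eventually.of_forall fun x => sq_nonneg _), ← ENNReal.ofReal_mul (by positivity)]
    refine ENNReal.ofReal_le_ofReal ?_
    have hI : 0 ≤ ∫ x, f x ^ 2 ∂P := integral_nonneg fun x => sq_nonneg _
    calc (1 / (N : ℝ)) ^ 2 * Var[fun ω => ∑ k ∈ Finset.range N, f (Z k ω); μ]
        ≤ (1 / (N : ℝ)) ^ 2 * ((C + 1) * N * ∫ x, f x ^ 2 ∂P) := by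
          gcongr
          refine (hC f hf hf2 N).trans ?_
          gcongr
          linarith
      _ = _ := by field_simp
  · have htop : ∫⁻ x, ENNReal.ofReal (f x ^ 2) ∂P = ∞ := by
      by_contra hne
      refine hf2 ((memLp_two_iff_integrable_sq hf.aestronglyMeasurable).2
        ⟨(hf.pow_const 2).aestronglyMeasurable, ?_⟩)
      rw [hasFiniteIntegral_iff_ofReal (Eventually.of_forall fun x => sq_nonneg _)]
      exact lt_top_iff_ne_top.2 hne
    rw [htop, ENNReal.mul_top (ENNReal.ofReal_pos.2 (by positivity)).ne']
    exact le_top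

variable {d : ℕ} {K p : EuclideanSpace ℝ (Fin d) → ℝ} {P : Measure (EuclideanSpace ℝ (Fin d))}

theorem measurable_scaledKernel (hK : Measurable K) (h : ℝ) :
    Measurable fun z : EuclideanSpace ℝ (Fin d) × EuclideanSpace ℝ (Fin d) =>
      scaledKernel K h z.1 z.2 := by
  unfold scaledKernel
  fun_prop

/-- Substituting `z = x + h u` leaves one factor `h^(-d)` from the squared kernel. The weight `1`
serves the squared error, a power of `1 + ‖x‖` the absolute error. -/
theorem lintegral_mul_lintegral_scaledKernel_sq (hKm : Measurable K)
    (hpm : Measurable p) (hP : P = volume.withDensity (fun x => ENNReal.ofReal (p x))) {h : ℝ}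
    (hh : 0 < h) {w : EuclideanSpace ℝ (Fin d) → ℝ≥0∞} (hw : Measurable w) :
    ∫⁻ x, w x * ∫⁻ z, ENNReal.ofReal (scaledKernel K h z x ^ 2) ∂P =
      ENNReal.ofReal ((h ^ d)⁻¹) * ∫⁻ u, ENNReal.ofReal (K u ^ 2) *
        ∫⁻ x, w x * ENNReal.ofReal (p (x + h • u)) := by
  have hs := measurable_scaledKernel hKm h
  have e1 : ∀ x, ∫⁻ z, ENNReal.ofReal (scaledKernel K h z x ^ 2) ∂P =
      ENNReal.ofReal ((h ^ d)⁻¹) *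
        ∫⁻ u, ENNReal.ofReal (K u ^ 2) * ENNReal.ofReal (p (x + h • u)) := fun x => by
    have hm : Measurable fun z => ENNReal.ofReal (scaledKernel K h z x ^ 2) :=
      ((hs.comp (measurable_id.prodMk measurable_const)).pow_const 2).ennreal_ofReal
    rw [hP, lintegral_withDensity_eq_lintegral_mul _ (by fun_prop) hm,
      lintegral_comp_add_smul ((hpm.ennreal_ofReal).mul hm) hh x, finrank_euclideanSpace_fin,
      ← lintegral_const_mul' _ _ (by simp), ← lintegral_const_mul' _ _ (by simp)]
    refine lintegral_congr fun u => ?_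
    simp only [Pi.mul_apply, scaledKernel, add_sub_cancel_left, smul_smul,
      inv_mul_cancel₀ hh.ne', one_smul]
    rw [mul_pow, ENNReal.ofReal_mul (by positivity)]
    have e : ENNReal.ofReal (h ^ d) * ENNReal.ofReal ((1 / h ^ d) ^ 2)
        = ENNReal.ofReal ((h ^ d)⁻¹) := by
      rw [← ENNReal.ofReal_mul (by positivity)]
      congr 1
      field_simp
    rw [← e]
    ring
  have hm2 : Measurable fun z : EuclideanSpace ℝ (Fin d) × EuclideanSpace ℝ (Fin d) =>
      w z.1 * (ENNReal.ofReal (K z.2 ^ 2) * ENNReal.ofReal (p (z.1 + h • z.2))) := by fun_prop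
  simp only [e1, mul_left_comm (w _)]
  rw [lintegral_const_mul' _ _ (by simp)]
  congr 1
  calc ∫⁻ x, w x * ∫⁻ u, ENNReal.ofReal (K u ^ 2) * ENNReal.ofReal (p (x + h • u))
      = ∫⁻ x, ∫⁻ u, w x * (ENNReal.ofReal (K u ^ 2) * ENNReal.ofReal (p (x + h • u))) := by
        refine lintegral_congr fun x => ?_
        rw [lintegral_const_mul _ (by fun_prop)]
    _ = ∫⁻ u, ∫⁻ x, w x * (ENNReal.ofReal (K u ^ 2) * ENNReal.ofReal (p (x + h • u))) :=
        lintegral_lintegral_swap hm2.aemeasurable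
    _ = _ := by
        refine lintegral_congr fun u => ?_
        simp only [mul_left_comm (w _)]
        rw [lintegral_const_mul _ (by fun_prop)]

/-- Under polynomial tails, the stochastic error has a weighted second moment that is bounded
like its plain second moment. -/
theorem exists_lintegral_weight_mul_le (hKm : Measurable K) (hpm : Measurable p)
    (hP : P = volume.withDensity (fun x => ENNReal.ofReal (p x))) {c r : ℝ}
    (hr : 2 * (d : ℝ) < r) (hKr : Integrable fun u => (1 + ‖u‖) ^ r * K u ^ 2)
    (hpr : ∀ᵐ x, p x ≤ c * (1 + ‖x‖) ^ (-r)) :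
    ∃ D : ℝ≥0∞, D ≠ ∞ ∧ ∀ h : ℝ, 0 < h → h ≤ 1 →
      ∫⁻ x, ENNReal.ofReal ((1 + ‖x‖) ^ (r / 2)) *
        ∫⁻ z, ENNReal.ofReal (scaledKernel K h z x ^ 2) ∂P ≤ ENNReal.ofReal ((h ^ d)⁻¹) * D := by
  have hr0 : 0 ≤ r := by linarith [Nat.cast_nonneg (α := ℝ) d]
  have hw : Measurable fun x : EuclideanSpace ℝ (Fin d) =>
    ENNReal.ofReal ((1 + ‖x‖) ^ (r / 2)) := by fun_prop
  set W : ℝ≥0∞ := ∫⁻ x, ENNReal.ofReal ((1 + ‖x‖) ^ (r / 2)) * ENNReal.ofReal (p x) with hW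
  have hWf : W ≠ ∞ := by
    -- The weight uses up half of the decay of `p`; the remaining exponent `r / 2` exceeds `d`.
    have hi : Integrable fun x : EuclideanSpace ℝ (Fin d) => c * (1 + ‖x‖) ^ (-(r / 2)) := by
      refine (integrable_one_add_norm ?_).const_mul c
      rw [finrank_euclideanSpace_fin]
      linarith
    have hi' := hi.lintegral_lt_top
    refine (lt_of_le_of_lt (lintegral_mono_ae ?_) hi').ne
    filter_upwards [hpr] with x hx
    rw [← ENNReal.ofReal_mul (by positivity)]
    refine ENNReal.ofReal_le_ofReal ?_
    have h1 : 0 < 1 + ‖x‖ := by positivity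
    calc (1 + ‖x‖) ^ (r / 2) * p x ≤ (1 + ‖x‖) ^ (r / 2) * (c * (1 + ‖x‖) ^ (-r)) := by gcongr
      _ = c * (1 + ‖x‖) ^ (-(r / 2)) := by
        rw [mul_left_comm, ← Real.rpow_add h1]
        congr 2
        ring
  refine ⟨(∫⁻ u, ENNReal.ofReal ((1 + ‖u‖) ^ r * K u ^ 2)) * W,
    ENNReal.mul_ne_top hKr.lintegral_lt_top.ne hWf, fun h hh hh1 => ?_⟩
  rw [lintegral_mul_lintegral_scaledKernel_sq hKm hpm hP hh hw, ← lintegral_mul_const' _ _ hWf]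
  refine mul_le_mul_right (lintegral_mono fun u => ?_) _
  have hu : ∫⁻ x, ENNReal.ofReal ((1 + ‖x‖) ^ (r / 2)) * ENNReal.ofReal (p (x + h • u)) ≤
      ENNReal.ofReal ((1 + ‖u‖) ^ r) * W := by
    have e : W = ∫⁻ x, ENNReal.ofReal ((1 + ‖x + h • u‖) ^ (r / 2)) *
        ENNReal.ofReal (p (x + h • u)) :=
      (lintegral_add_right_eq_self (fun x => ENNReal.ofReal ((1 + ‖x‖) ^ (r / 2)) *
        ENNReal.ofReal (p x)) (h • u)).symm
    rw [e, ← lintegral_const_mul' _ _ (by simp)]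
    refine lintegral_mono fun x => ?_
    rw [← mul_assoc]
    refine mul_le_mul_left ?_ _
    rw [← ENNReal.ofReal_mul (by positivity)]
    refine ENNReal.ofReal_le_ofReal ?_
    have h1 : ‖x‖ ≤ ‖x + h • u‖ + ‖u‖ := by
      calc ‖x‖ = ‖(x + h • u) - h • u‖ := by rw [add_sub_cancel_right]
        _ ≤ ‖x + h • u‖ + ‖h • u‖ := norm_sub_le _ _
        _ ≤ ‖x + h • u‖ + ‖u‖ := by
          rw [norm_smul, Real.norm_of_nonneg hh.le]
          gcongr
          exact mul_le_of_le_one_left (norm_nonneg _) hh1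
    -- Because `h ≤ 1`, the weight at `x` is dominated by the weight at `x + h u` times a factor in
    -- `u` that the moment of `K²` absorbs.
    have h2 : 1 + ‖x‖ ≤ (1 + ‖u‖) * (1 + ‖x + h • u‖) := by
      nlinarith [mul_nonneg (norm_nonneg u) (norm_nonneg (x + h • u))]
    calc (1 + ‖x‖) ^ (r / 2) ≤ ((1 + ‖u‖) * (1 + ‖x + h • u‖)) ^ (r / 2) := by gcongr
      _ = (1 + ‖u‖) ^ (r / 2) * (1 + ‖x + h • u‖) ^ (r / 2) :=
        Real.mul_rpow (by positivity) (by positivity)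
      _ ≤ (1 + ‖u‖) ^ r * (1 + ‖x + h • u‖) ^ (r / 2) := by
        gcongr
        · linarith [norm_nonneg u]
        · linarith
  refine (mul_le_mul_right hu _).trans_eq ?_
  rw [ENNReal.ofReal_mul (by positivity)]
  ring

end Variance

/-! ### The error bounds for measurable kernels and densities -/

section Errors

variable {Ω : Type*} [MeasurableSpace Ω] {μ : Measure Ω} [IsProbabilityMeasure μ] {d : ℕ}
  {K p : EuclideanSpace ℝ (Fin d) → ℝ} {P : Measure (EuclideanSpace ℝ (Fin d))}
  [IsProbabilityMeasure P] {h : ℕ → ℝ} {Z : ℕ → Ω → EuclideanSpace ℝ (Fin d)}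

theorem measurable_kde (hKm : Measurable K) (hZ : ∀ k, Measurable (Z k)) (h : ℝ) (N : ℕ) :
    Measurable fun z : Ω × EuclideanSpace ℝ (Fin d) => kde K h Z N z.1 z.2 := by
  unfold kde
  refine Measurable.const_mul (Finset.measurable_fun_sum _ fun k _ => ?_) _
  exact (measurable_scaledKernel hKm h).comp
    (((hZ k).comp measurable_fst).prodMk measurable_snd)

/-- The error splits into a stochastic part and a bias, centred at `m`, the mean of the estimator. -/
theorem exists_error_decomposition (hKm : Measurable K) (hpm : Measurable p)
    (hp : ∀ x, 0 ≤ p x) (hP : P = volume.withDensity (fun x => ENNReal.ofReal (p x)))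
    (hA : Assumptions K h p) (hZ : IsIIDOrStationaryWithGap μ P Z) :
    ∃ C A B : ℝ, 0 < C ∧ 0 ≤ A ∧ 0 ≤ B ∧ ∀ N : ℕ, 0 < N →
      ∃ m : EuclideanSpace ℝ (Fin d) → ℝ, Measurable m ∧
        (∀ x, ∫⁻ ω, ‖kde K (h N) Z N ω x - m x‖ₑ ^ 2 ∂μ ≤
          ENNReal.ofReal (C / N) * ∫⁻ z, ENNReal.ofReal (scaledKernel K (h N) z x ^ 2) ∂P) ∧
        ∫⁻ x, ‖m x - p x‖ₑ ≤ ENNReal.ofReal (A * h N ^ 2) ∧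
        ∫⁻ x, ‖m x - p x‖ₑ ^ 2 ≤ ENNReal.ofReal (B * h N ^ 4) := by
  obtain ⟨C, hC, hvar⟩ := hZ.exists_lintegral_average_le
  have hK1 : Integrable K := memLp_one_iff_integrable.1 hA.K_L1
  have hKsecond : Integrable fun u => ‖u‖ ^ 2 * K u := by
    simpa only [abs_of_nonneg (hA.K_nonneg _)] using hA.K_second_moment
  obtain ⟨A, B, hA', hB, hbias⟩ := exists_bias_le hA.K_nonneg hKm hK1 hA.K_mass
    hA.K_first_moment hKsecond hp hpm hA.p_sobolev_one hA.p_sobolev_two hP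
  refine ⟨C, A.toReal, B.toReal, hC, ENNReal.toReal_nonneg, ENNReal.toReal_nonneg,
    fun N hN => ⟨fun x => ∫ z, scaledKernel K (h N) z x ∂P, ?_, fun x => ?_, ?_, ?_⟩⟩
  · exact (StronglyMeasurable.integral_prod_right' (f := fun w : EuclideanSpace ℝ (Fin d) ×
      EuclideanSpace ℝ (Fin d) => scaledKernel K (h N) w.2 w.1)
      ((measurable_scaledKernel hKm (h N)).comp measurable_swap).stronglyMeasurable).measurable
  · exact hvar (fun z => scaledKernel K (h N) z x) ((measurable_scaledKernel hKm (h N)).comp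
      (measurable_id.prodMk measurable_const)) N hN
  · rw [ENNReal.ofReal_mul ENNReal.toReal_nonneg, ENNReal.ofReal_toReal hA']
    exact (hbias (h N) (hA.h_pos N)).1
  · rw [ENNReal.ofReal_mul ENNReal.toReal_nonneg, ENNReal.ofReal_toReal hB]
    exact (hbias (h N) (hA.h_pos N)).2

theorem MISE_isBigOSeq_of_measurable (hKm : Measurable K) (hpm : Measurable p)
    (hp : ∀ x, 0 ≤ p x) (hP : P = volume.withDensity (fun x => ENNReal.ofReal (p x)))
    (hA : Assumptions K h p) (hZ : IsIIDOrStationaryWithGap μ P Z) :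
    IsBigOSeq (fun N => MISE μ (kde K (h N) Z N) p) (sqBound d h) := by
  obtain ⟨C, A, B, hC, -, hB, herr⟩ := exists_error_decomposition hKm hpm hp hP hA hZ
  have hKsq : ∫⁻ u, ENNReal.ofReal (K u ^ 2) = ENNReal.ofReal (∫ u, K u ^ 2) :=
    (ofReal_integral_eq_lintegral_ofReal hA.K_L2.integrable_sq
      (Eventually.of_forall fun x => sq_nonneg _)).symm
  have hpmass : ∫⁻ x, ENNReal.ofReal (p x) = 1 := by
    have h1 := measure_univ (μ := P)
    rwa [hP, withDensity_apply _ MeasurableSet.univ, Measure.restrict_univ] at h1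
  set k2 := ∫ u, K u ^ 2 with hk2
  have hk0 : 0 ≤ k2 := integral_nonneg fun x => sq_nonneg _
  refine ⟨2 * C * k2 + 2 * B, ?_⟩
  filter_upwards [eventually_gt_atTop 0] with N hN
  have hN' : (0 : ℝ) < N := by exact_mod_cast hN
  have hh := hA.h_pos N
  obtain ⟨m, hmm, hvar, -, hbias⟩ := herr N hN
  have hq := measurable_kde hKm (fun k => (hZ.measurePreserving k).measurable) (h N) N
  have hvarI : ∫⁻ x, ∫⁻ ω, ‖kde K (h N) Z N ω x - m x‖ₑ ^ 2 ∂μ ≤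
      ENNReal.ofReal (C / N) * (ENNReal.ofReal ((h N ^ d)⁻¹) * ENNReal.ofReal k2) := by
    refine (lintegral_mono hvar).trans_eq ?_
    rw [lintegral_const_mul' _ _ (by simp)]
    have h1 := lintegral_mul_lintegral_scaledKernel_sq hKm hpm hP hh
      (w := fun _ => 1) measurable_const
    simp only [one_mul] at h1
    rw [h1]
    simp only [lintegral_add_right_eq_self fun x => ENNReal.ofReal (p x)]
    rw [hpmass]
    simp only [mul_one]
    rw [hKsq]
  have hm1 : Measurable fun z : Ω × EuclideanSpace ℝ (Fin d) =>
      2 * ‖kde K (h N) Z N z.1 z.2 - m z.2‖ₑ ^ 2 + 2 * ‖m z.2 - p z.2‖ₑ ^ 2 := by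
    have h1 : Measurable fun z : Ω × EuclideanSpace ℝ (Fin d) => m z.2 := by fun_prop
    exact (((hq.sub h1).enorm.pow_const 2).const_mul 2).add (by fun_prop)
  calc MISE μ (kde K (h N) Z N) p
      ≤ ∫⁻ ω, (∫⁻ x, (2 * ‖kde K (h N) Z N ω x - m x‖ₑ ^ 2 + 2 * ‖m x - p x‖ₑ ^ 2)) ∂μ := by
        refine lintegral_mono fun ω => lintegral_mono fun x => ?_
        have e : ∀ a : ℝ, ‖a‖ₑ ^ 2 = ENNReal.ofReal (a ^ 2) := fun a => by
          rw [← ofReal_norm, ← ENNReal.ofReal_pow (norm_nonneg _), Real.norm_eq_abs, sq_abs]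
        simp only [e]
        rw [show (2 : ℝ≥0∞) = ENNReal.ofReal 2 by simp, ← ENNReal.ofReal_mul zero_le_two,
          ← ENNReal.ofReal_mul zero_le_two, ← ENNReal.ofReal_add (by positivity) (by positivity)]
        refine ENNReal.ofReal_le_ofReal ?_
        nlinarith [sq_nonneg (kde K (h N) Z N ω x - m x - (m x - p x))]
    _ = 2 * (∫⁻ x, ∫⁻ ω, ‖kde K (h N) Z N ω x - m x‖ₑ ^ 2 ∂μ)
        + 2 * ∫⁻ x, ‖m x - p x‖ₑ ^ 2 := by
        rw [lintegral_lintegral_swap hm1.aemeasurable]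
        have e : ∀ x, ∫⁻ ω, (2 * ‖kde K (h N) Z N ω x - m x‖ₑ ^ 2 + 2 * ‖m x - p x‖ₑ ^ 2) ∂μ
            = 2 * (∫⁻ ω, ‖kde K (h N) Z N ω x - m x‖ₑ ^ 2 ∂μ) + 2 * ‖m x - p x‖ₑ ^ 2 := fun x => by
          rw [lintegral_add_right _ measurable_const, lintegral_const_mul' _ _ (by simp)]
          simp
        simp only [e]
        rw [lintegral_add_right _ (by fun_prop), lintegral_const_mul' _ _ (by simp),
          lintegral_const_mul' _ _ (by simp)]
    _ ≤ 2 * (ENNReal.ofReal (C / N) * (ENNReal.ofReal ((h N ^ d)⁻¹) * ENNReal.ofReal k2))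
        + 2 * ENNReal.ofReal (B * h N ^ 4) := by gcongr
    _ ≤ ENNReal.ofReal ((2 * C * k2 + 2 * B) * sqBound d h N) := by
        rw [show (2 : ℝ≥0∞) = ENNReal.ofReal 2 by simp, ← ENNReal.ofReal_mul (by positivity),
          ← ENNReal.ofReal_mul (by positivity), ← ENNReal.ofReal_mul (by positivity),
          ← ENNReal.ofReal_mul (by positivity),
          ← ENNReal.ofReal_add (by positivity) (by positivity)]
        refine ENNReal.ofReal_le_ofReal ?_
        have h1 : 0 ≤ 1 / ((N : ℝ) * h N ^ d) := by positivity
        have h2 : 0 ≤ h N ^ 4 := by positivity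
        have h3 : C / N * ((h N ^ d)⁻¹ * k2) = C * k2 * (1 / ((N : ℝ) * h N ^ d)) := by
          field_simp
        have h4 : 0 ≤ C * k2 := by positivity
        rw [h3, sqBound]
        nlinarith [mul_nonneg h4 h2, mul_nonneg hB h1]

theorem MIAE_isBigOSeq_of_measurable (hKm : Measurable K) (hpm : Measurable p)
    (hp : ∀ x, 0 ≤ p x) (hP : P = volume.withDensity (fun x => ENNReal.ofReal (p x)))
    (hA : Assumptions K h p) (hZ : IsIIDOrStationaryWithGap μ P Z) {c r : ℝ}
    (hr : 2 * (d : ℝ) < r) (hKr : Integrable fun u => (1 + ‖u‖) ^ r * K u ^ 2)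
    (hpr : ∀ᵐ x, p x ≤ c * (1 + ‖x‖) ^ (-r)) :
    IsBigOSeq (fun N => MIAE μ (kde K (h N) Z N) p) (absBound d h) := by
  obtain ⟨C, A, B, hC, hA0, -, herr⟩ := exists_error_decomposition hKm hpm hp hP hA hZ
  obtain ⟨D, hD, hweight⟩ := exists_lintegral_weight_mul_le hKm hpm hP hr hKr hpr
  set W : ℝ≥0∞ := ∫⁻ x : EuclideanSpace ℝ (Fin d), ENNReal.ofReal ((1 + ‖x‖) ^ (-(r / 2)))
    with hW
  have hWf : W ≠ ∞ := by
    refine (Integrable.lintegral_lt_top (integrable_one_add_norm ?_)).ne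
    rw [finrank_euclideanSpace_fin]
    linarith
  refine ⟨√(W.toReal * C * D.toReal) + A, ?_⟩
  filter_upwards [eventually_gt_atTop 0, hA.h_tendsto.eventually_le_const one_pos] with N hN hh1
  have hN' : (0 : ℝ) < N := by exact_mod_cast hN
  have hh := hA.h_pos N
  obtain ⟨m, hmm, hvar, hbias, -⟩ := herr N hN
  have hq := measurable_kde hKm (fun k => (hZ.measurePreserving k).measurable) (h N) N
  have hqm : Measurable fun z : Ω × EuclideanSpace ℝ (Fin d) =>
      ‖kde K (h N) Z N z.1 z.2 - m z.2‖ₑ := (hq.sub (hmm.comp measurable_snd)).enorm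
  set S : EuclideanSpace ℝ (Fin d) → ℝ≥0∞ := fun x => ∫⁻ ω, ‖kde K (h N) Z N ω x - m x‖ₑ ∂μ
    with hS
  have hSm : Measurable S := hqm.lintegral_prod_left'
  have hS2 : ∀ x, S x ^ 2 ≤ ENNReal.ofReal (C / N) *
      ∫⁻ z, ENNReal.ofReal (scaledKernel K (h N) z x ^ 2) ∂P := fun x => by
    have h1 := sq_lintegral_le (ν := μ)
      (hqm.comp (measurable_id.prodMk (measurable_const (a := x)))).aemeasurable
    rw [measure_univ, one_mul] at h1
    exact h1.trans (hvar x)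
  -- Weighted Cauchy–Schwarz: `S` is divided and multiplied by `(1 + ‖x‖)^(r/4)`. The first factor
  -- squares to an integrable function as `r / 2 > d`, the second to the weighted second moment.
  have hSI : (∫⁻ x, S x) ^ 2 ≤
      ENNReal.ofReal (W.toReal * C * D.toReal * (1 / ((N : ℝ) * h N ^ d))) := by
    have hpos : ∀ x : EuclideanSpace ℝ (Fin d), 0 < 1 + ‖x‖ := fun x => by positivity
    have e1 : ∀ x, S x = ENNReal.ofReal ((1 + ‖x‖) ^ (-(r / 4))) *
        (ENNReal.ofReal ((1 + ‖x‖) ^ (r / 4)) * S x) := fun x => by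
      rw [← mul_assoc, ← ENNReal.ofReal_mul (Real.rpow_nonneg (hpos x).le _),
        ← Real.rpow_add (hpos x), neg_add_cancel, Real.rpow_zero, ENNReal.ofReal_one, one_mul]
    have e2 : ∀ (s : ℝ) (x : EuclideanSpace ℝ (Fin d)),
        ENNReal.ofReal ((1 + ‖x‖) ^ s) ^ 2 = ENNReal.ofReal ((1 + ‖x‖) ^ (s * 2)) := fun s x => by
      rw [← ENNReal.ofReal_pow (Real.rpow_nonneg (hpos x).le _), Real.rpow_mul (hpos x).le,
        Real.rpow_two]
    calc (∫⁻ x, S x) ^ 2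
        = (∫⁻ x, ENNReal.ofReal ((1 + ‖x‖) ^ (-(r / 4))) *
          (ENNReal.ofReal ((1 + ‖x‖) ^ (r / 4)) * S x)) ^ 2 := by
          rw [lintegral_congr e1]
      _ ≤ (∫⁻ x : EuclideanSpace ℝ (Fin d), ENNReal.ofReal ((1 + ‖x‖) ^ (-(r / 4))) ^ 2) *
          ∫⁻ x, (ENNReal.ofReal ((1 + ‖x‖) ^ (r / 4)) * S x) ^ 2 :=
          sq_lintegral_mul_le (by fun_prop) (by fun_prop)
      _ = W * ∫⁻ x, ENNReal.ofReal ((1 + ‖x‖) ^ (r / 2)) * S x ^ 2 := by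
          simp only [mul_pow, e2]
          rw [show -(r / 4) * 2 = -(r / 2) by ring, show r / 4 * 2 = r / 2 by ring]
      _ ≤ W * ∫⁻ x, ENNReal.ofReal (C / N) * (ENNReal.ofReal ((1 + ‖x‖) ^ (r / 2)) *
          ∫⁻ z, ENNReal.ofReal (scaledKernel K (h N) z x ^ 2) ∂P) := by
          refine mul_le_mul_right (lintegral_mono fun x => ?_) _
          rw [mul_left_comm]
          exact mul_le_mul_right (hS2 x) _
      _ ≤ W * (ENNReal.ofReal (C / N) * (ENNReal.ofReal ((h N ^ d)⁻¹) * D)) := by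
          rw [lintegral_const_mul' _ _ (by simp)]
          gcongr
          exact hweight (h N) hh hh1
      _ = _ := by
          conv_lhs => rw [← ENNReal.ofReal_toReal hWf, ← ENNReal.ofReal_toReal hD]
          have hW0 : 0 ≤ W.toReal := ENNReal.toReal_nonneg
          rw [← ENNReal.ofReal_mul (by positivity), ← ENNReal.ofReal_mul (by positivity),
            ← ENNReal.ofReal_mul (by positivity)]
          congr 1
          field_simp
  have hSI' : ∫⁻ x, S x ≤
      ENNReal.ofReal (√(W.toReal * C * D.toReal) * (1 / √((N : ℝ) * h N ^ d))) := by
    have hW0 : 0 ≤ W.toReal := ENNReal.toReal_nonneg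
    have hD0 : 0 ≤ D.toReal := ENNReal.toReal_nonneg
    rw [← ENNReal.pow_le_pow_left_iff two_ne_zero]
    refine hSI.trans_eq ?_
    rw [← ENNReal.ofReal_pow (by positivity), mul_pow, Real.sq_sqrt (by positivity), div_pow,
      one_pow, Real.sq_sqrt (by positivity)]
  calc MIAE μ (kde K (h N) Z N) p
      ≤ ∫⁻ ω, (∫⁻ x, (‖kde K (h N) Z N ω x - m x‖ₑ + ‖m x - p x‖ₑ)) ∂μ := by
        refine lintegral_mono fun ω => lintegral_mono fun x => ?_
        rw [← Real.norm_eq_abs, ofReal_norm, ← sub_add_sub_cancel _ (m x) _]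
        exact enorm_add_le _ _
    _ = (∫⁻ x, S x) + ∫⁻ x, ‖m x - p x‖ₑ := by
        rw [lintegral_lintegral_swap (hqm.add (by fun_prop)).aemeasurable]
        have e : ∀ x, ∫⁻ ω, (‖kde K (h N) Z N ω x - m x‖ₑ + ‖m x - p x‖ₑ) ∂μ
            = S x + ‖m x - p x‖ₑ := fun x => by
          rw [lintegral_add_right _ measurable_const]
          simp [hS]
        simp only [e]
        rw [lintegral_add_right _ (by fun_prop)]
    _ ≤ ENNReal.ofReal (√(W.toReal * C * D.toReal) * (1 / √((N : ℝ) * h N ^ d)))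
        + ENNReal.ofReal (A * h N ^ 2) := add_le_add hSI' hbias
    _ ≤ ENNReal.ofReal ((√(W.toReal * C * D.toReal) + A) * absBound d h N) := by
        rw [← ENNReal.ofReal_add (by positivity) (by positivity)]
        refine ENNReal.ofReal_le_ofReal ?_
        have h1 : 0 ≤ 1 / √((N : ℝ) * h N ^ d) := by positivity
        have h2 : 0 ≤ h N ^ 2 := by positivity
        have h3 : 0 ≤ √(W.toReal * C * D.toReal) := Real.sqrt_nonneg _
        rw [absBound]
        nlinarith [mul_nonneg h3 h2, mul_nonneg hA0 h1]

end Errors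

/-! ### Reduction to measurable kernels and densities -/

section Reduction

variable {d : ℕ} {K K' p p' : EuclideanSpace ℝ (Fin d) → ℝ} {h : ℕ → ℝ}

theorem MemSobolev.congr_ae {k : ℕ} {q : ℝ≥0∞} (hp : MemSobolev k q p) (e : p =ᵐ[volume] p') :
    MemSobolev k q p' := by
  refine ⟨hp.1.ae_eq e, fun n hn a => ?_⟩
  obtain ⟨g, hg, hgφ⟩ := hp.2 n hn a
  refine ⟨g, hg, fun φ hφ hφc => ?_⟩
  rw [← hgφ φ hφ hφc]
  refine integral_congr_ae ?_
  filter_upwards [e] with x hx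
  rw [hx]

theorem Assumptions.congr_ae (hA : Assumptions K h p) (hK' : ∀ u, 0 ≤ K' u)
    (eK : K =ᵐ[volume] K') (ep : p =ᵐ[volume] p') : Assumptions K' h p' where
  K_nonneg := hK'
  K_L1 := hA.K_L1.ae_eq eK
  K_L2 := hA.K_L2.ae_eq eK
  K_mass := by rw [← hA.K_mass, integral_congr_ae eK]
  K_first_moment := by
    rw [← hA.K_first_moment]
    refine integral_congr_ae ?_
    filter_upwards [eK] with u hu
    rw [hu]
  K_second_moment := by
    refine hA.K_second_moment.congr ?_
    filter_upwards [eK] with u hu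
    rw [hu]
  h_pos := hA.h_pos
  h_tendsto := hA.h_tendsto
  Nh_tendsto := hA.Nh_tendsto
  p_sobolev_one := hA.p_sobolev_one.congr_ae ep
  p_sobolev_two := hA.p_sobolev_two.congr_ae ep

/-- For fixed `ω` and `k`, the map `x ↦ (Z_k - x) / b` pulls Lebesgue null sets back to null sets.
The law of the sample plays no role. -/
theorem kde_ae_eq {Ω : Type*} (eK : K =ᵐ[volume] K') {b : ℝ} (hb : 0 < b)
    (Z : ℕ → Ω → EuclideanSpace ℝ (Fin d)) (N : ℕ) (ω : Ω) :
    kde K b Z N ω =ᵐ[volume] kde K' b Z N ω := by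
  have hk : ∀ k, ∀ᵐ x, K (b⁻¹ • (Z k ω - x)) = K' (b⁻¹ • (Z k ω - x)) := fun k => by
    have hq : Measure.QuasiMeasurePreserving
        (fun x : EuclideanSpace ℝ (Fin d) => b⁻¹ • (Z k ω - x)) volume volume := by
      have h1 : Measure.QuasiMeasurePreserving (fun x : EuclideanSpace ℝ (Fin d) => b⁻¹ • x)
          volume volume := by
        refine ⟨measurable_const_smul _, ?_⟩
        rw [Measure.map_addHaar_smul _ (inv_ne_zero hb.ne')]
        exact Measure.smul_absolutelyContinuous
      exact h1.comp (Measure.measurePreserving_sub_left volume (Z k ω)).quasiMeasurePreserving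
    exact hq.ae eK
  filter_upwards [ae_all_iff.2 hk] with x hx
  simp only [kde, scaledKernel, hx]

/-- Measurable versions of `K` and `p` justify Tonelli's theorem; neither error changes, since both
integrate over `x` for each fixed `ω`. -/
theorem exists_measurable_nonneg_ae_eq {α : Type*} [MeasurableSpace α] {ν : Measure α} {f : α → ℝ}
    (hf : AEStronglyMeasurable f ν) (hf0 : ∀ x, 0 ≤ f x) :
    ∃ f' : α → ℝ, Measurable f' ∧ (∀ x, 0 ≤ f' x) ∧ f =ᵐ[ν] f' := by
  refine ⟨fun x => max (hf.mk f x) 0, hf.stronglyMeasurable_mk.measurable.max measurable_const,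
    fun x => le_max_right _ _, ?_⟩
  filter_upwards [hf.ae_eq_mk] with x hx
  rw [← hx, max_eq_left (hf0 x)]

variable {Ω : Type*} [MeasurableSpace Ω] {μ : Measure Ω} [IsProbabilityMeasure μ]
  {P : Measure (EuclideanSpace ℝ (Fin d))} [IsProbabilityMeasure P]
  {Z : ℕ → Ω → EuclideanSpace ℝ (Fin d)}

theorem MISE_isBigOSeq (hp : ∀ x, 0 ≤ p x)
    (hP : P = volume.withDensity (fun x => ENNReal.ofReal (p x)))
    (hA : Assumptions K h p) (hZ : IsIIDOrStationaryWithGap μ P Z) :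
    IsBigOSeq (fun N => MISE μ (kde K (h N) Z N) p) (sqBound d h) := by
  obtain ⟨K', hKm, hK0, eK⟩ := exists_measurable_nonneg_ae_eq hA.K_L1.1 hA.K_nonneg
  obtain ⟨p', hpm, hp0, ep⟩ := exists_measurable_nonneg_ae_eq hA.p_sobolev_one.1.1 hp
  have hP' : P = volume.withDensity (fun x => ENNReal.ofReal (p' x)) := by
    rw [hP]
    exact withDensity_congr_ae (ep.mono fun x hx => by simp only [hx])
  convert MISE_isBigOSeq_of_measurable hKm hpm hp0 hP' (hA.congr_ae hK0 eK ep) hZ using 2 with N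
  refine lintegral_congr fun ω => lintegral_congr_ae ?_
  filter_upwards [ep, kde_ae_eq eK (hA.h_pos N) Z N ω] with x h1 h2
  rw [h1, h2]

theorem MIAE_isBigOSeq (hp : ∀ x, 0 ≤ p x)
    (hP : P = volume.withDensity (fun x => ENNReal.ofReal (p x)))
    (hA : Assumptions K h p) (hZ : IsIIDOrStationaryWithGap μ P Z) (hT : TailCondition K p) :
    IsBigOSeq (fun N => MIAE μ (kde K (h N) Z N) p) (absBound d h) := by
  obtain ⟨K', hKm, hK0, eK⟩ := exists_measurable_nonneg_ae_eq hA.K_L1.1 hA.K_nonneg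
  obtain ⟨p', hpm, hp0, ep⟩ := exists_measurable_nonneg_ae_eq hA.p_sobolev_one.1.1 hp
  obtain ⟨c, r, -, hr, hKr, hpr⟩ := hT
  have hP' : P = volume.withDensity (fun x => ENNReal.ofReal (p' x)) := by
    rw [hP]
    exact withDensity_congr_ae (ep.mono fun x hx => by simp only [hx])
  have hKr' : Integrable fun u => (1 + ‖u‖) ^ r * K' u ^ 2 :=
    hKr.congr (eK.mono fun u hu => by simp only [hu])
  have hpr' : ∀ᵐ x, p' x ≤ c * (1 + ‖x‖) ^ (-r) := ep.mono fun x hx => hx ▸ hpr x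
  convert MIAE_isBigOSeq_of_measurable hKm hpm hp0 hP' (hA.congr_ae hK0 eK ep) hZ hr hKr' hpr'
    using 2 with N
  refine lintegral_congr fun ω => lintegral_congr_ae ?_
  filter_upwards [ep, kde_ae_eq eK (hA.h_pos N) Z N ω] with x h1 h2
  rw [h1, h2]

end Reduction

end KDE

end

theorem mainTheorem9 {Ω : Type*} [MeasurableSpace Ω] (μ : Measure Ω) [IsProbabilityMeasure μ]
    {d : ℕ} (hd : 0 < d)
    (P : Measure (EuclideanSpace ℝ (Fin d))) [IsProbabilityMeasure P]
    (p : EuclideanSpace ℝ (Fin d) → ℝ) (hp : ∀ x, 0 ≤ p x)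
    (hP : P = volume.withDensity (fun x => ENNReal.ofReal (p x)))
    (K : EuclideanSpace ℝ (Fin d) → ℝ) (h : ℕ → ℝ) (hA : KDE.Assumptions K h p)
    (Z : ℕ → Ω → EuclideanSpace ℝ (Fin d)) (hZ : KDE.IsIIDOrStationaryWithGap μ P Z) :
    -- error bounds for a general bandwidth
    (KDE.TailCondition K p →
      KDE.IsBigOSeq (fun N => KDE.MIAE μ (KDE.kde K (h N) Z N) p) (KDE.absBound d h)) ∧
    KDE.IsBigOSeq (fun N => KDE.MISE μ (KDE.kde K (h N) Z N) p) (KDE.sqBound d h) ∧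
    -- rates for the balanced bandwidth
    ((h =Θ[atTop] fun N : ℕ => (N : ℝ) ^ (-(1 : ℝ) / (d + 4))) →
      (KDE.TailCondition K p →
        KDE.IsBigOSeq (fun N => KDE.MIAE μ (KDE.kde K (h N) Z N) p)
          (fun N => (N : ℝ) ^ (-(2 : ℝ) / (d + 4)))) ∧
      KDE.IsBigOSeq (fun N => KDE.MISE μ (KDE.kde K (h N) Z N) p)
        (fun N => (N : ℝ) ^ (-(4 : ℝ) / (d + 4)))) ∧
    -- optimality of the balanced bandwidth: no bandwidth gives bounds of smaller order, and
    -- exactly the bandwidths of order `N ^ (-1 / (d + 4))` attain this order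
    (∀ b : ℕ → ℝ, (∀ N, 0 < b N) →
      ((fun N : ℕ => (N : ℝ) ^ (-(2 : ℝ) / (d + 4))) =O[atTop] KDE.absBound d b) ∧
      ((fun N : ℕ => (N : ℝ) ^ (-(4 : ℝ) / (d + 4))) =O[atTop] KDE.sqBound d b) ∧
      ((KDE.absBound d b =O[atTop] fun N : ℕ => (N : ℝ) ^ (-(2 : ℝ) / (d + 4))) ↔
        b =Θ[atTop] fun N : ℕ => (N : ℝ) ^ (-(1 : ℝ) / (d + 4))) ∧
      ((KDE.sqBound d b =O[atTop] fun N : ℕ => (N : ℝ) ^ (-(4 : ℝ) / (d + 4))) ↔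
        b =Θ[atTop] fun N : ℕ => (N : ℝ) ^ (-(1 : ℝ) / (d + 4)))) := by
  have hrate : ∀ (c : ℝ) (N : ℕ), 0 ≤ (N : ℝ) ^ c := fun c N => Real.rpow_nonneg N.cast_nonneg c
  have hMISE := KDE.MISE_isBigOSeq hp hP hA hZ
  have hMIAE := fun hT => KDE.MIAE_isBigOSeq hp hP hA hZ hT
  refine ⟨hMIAE, hMISE, fun hh => ⟨fun hT => ?_, ?_⟩, fun b hb => ⟨?_, ?_, ?_, ?_⟩⟩
  · exact (hMIAE hT).trans_isBigO ((KDE.absBound_isBigO_rpow_iff hd hA.h_pos).2 hh)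
      fun N => hrate _ N
  · exact hMISE.trans_isBigO ((KDE.sqBound_isBigO_rpow_iff hd hA.h_pos).2 hh) fun N => hrate _ N
  · exact KDE.rpow_isBigO_absBound d hb
  · exact KDE.rpow_isBigO_sqBound d hb
  · exact KDE.absBound_isBigO_rpow_iff hd hb
  · exact KDE.sqBound_isBigO_rpow_iff hd hb
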